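/- **Definitions.** A *hyperbolic cone manifold* $M$ with singular locus $\Sigma$ is a connected 3-manifold with a complete length metric, together with a closed (compact, possibly empty) 1-manifold $\Sigma\subset M$, such that $M$ is locally isometric to $\mathbb H^3$ at points of $M\setminus\Sigma$, and at points of $\Sigma$ it is locally isometric to hyperbolic 3-space with some cone angle $\alpha>0$ along an axis (metric $d\rho^2+\sinh^2\!\rho\,d\theta^2+\cosh^2\!\rho\,dz^2$, $\theta\in\mathbb R/\alpha\mathbb Z$), with $\Sigma$ corresponding to the axis. (The cone angle is then constant along each component of $\Sigma$.) The *tube radius* about $\Sigma$ is the supremum of all $r>0$ such that the open $r$-neighborhood of $\Sigma$ is an embedded tube, i.e. a disjoint union of finitely many solid tori, each the quotient of $\{\rho<r\}$ in the above model by $(\rho,\theta,z)\sim(\rho,\theta+t,z+\ell)$ for some $\ell>0$ and $t\in\mathbb R$, whose cores are the components of $\Sigma$. A *horoball neighborhood* $U$ of a cusp is an open subset of $M\setminus\Sigma$ isometrically parametrized (for the path metrics) by $\{(w,s)\in\mathbb C\times(0,\infty): s>h\}/\Lambda$, the quotient of an open horoball in the upper half-space model of $\mathbb H^3$ by a lattice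 $\Lambda\subset\mathbb C$ of horizontal translations; $\partial U$ denotes the Euclidean torus $\{s=h\}/\Lambda$ with the induced metric $|dw|/h$, and a *meridian* of $\partial U$ is a shortest homotopically nontrivial simple closed curve on it. **Lemma.** Let $M$ be a hyperbolic cone manifold with singular locus $\Sigma$ and with a (torus) cusp, for instance exactly one. Let $R$ be a real number with $R\ge\log(2/\sqrt3)$ such that the tube radius about $\Sigma$ is at least $R$ (for instance equal to $R$). Then there exists a horoball neighborhood $U$ of the cusp such that the meridian of $\partial U$ has length at least $1-e^{-2R}$. -/

import Mathlib

open Set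

noncomputable section

/-! ### The model geometries -/

/-- Hyperbolic 3-space, in the upper half-space model `ℂ × (0, ∞)`. -/
structure HypSpace where
  base : ℂ
  height : ℝ
  height_pos : 0 < height

/-- The hyperbolic distance of the upper half-space model, given by
`cosh d = 1 + (|z - z'|² + (t - t')²) / (2 t t')`. -/
def HypSpace.hdist (p q : HypSpace) : ℝ :=
  Real.arcosh (1 + (‖p.base - q.base‖ ^ 2 + (p.height - q.height) ^ 2) /
    (2 * p.height * q.height))

/-- The parabolic isometry of hyperbolic 3-space which translates by `v` horizontally. -/
def HypSpace.translate (v : ℂ) (p : HypSpace) : HypSpace :=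
  ⟨p.base + v, p.height, p.height_pos⟩

/-- Cylindrical coordinates `(ρ, θ, z)` about a singular axis: `ρ` is the distance to the axis,
`θ` the angular coordinate and `z` the arc length along the axis. The same triples are used for
every cone angle `α`; the angle `θ` is read modulo `α`, and is irrelevant when `ρ = 0`
(see `ConePoint.cdist`). -/
structure ConePoint where
  radius : ℝ
  angle : ℝ
  axial : ℝ
  radius_nonneg : 0 ≤ radius

/-- The distance in the space with metric `dρ² + sinh² ρ dθ² + cosh² ρ dz²`, `θ ∈ ℝ / αℤ`
(hyperbolic 3-space with cone angle `α` along an axis), as a pseudo-distance on coordinate triples.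
The norm of `AddCircle α` is the distance of the two angles modulo `α`. If it is at most `π`, the
formula is the hyperbolic law of cosines in cylindrical coordinates; if it is larger than `π`
(only possible for `α > 2π`), a shortest path runs through the axis, and unfolding the two half
planes spanned by it gives the same formula with angle `π`. -/
def ConePoint.cdist (α : ℝ) (p q : ConePoint) : ℝ :=
  Real.arcosh
    (Real.cosh p.radius * Real.cosh q.radius * Real.cosh (p.axial - q.axial) -
      Real.sinh p.radius * Real.sinh q.radius *
        Real.cos (min Real.pi ‖((p.angle - q.angle : ℝ) : AddCircle α)‖))

/-- `F` maps some open ball of positive radius about `p`, with respect to the model (pseudo-)distance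
`d`, isometrically onto the ball of the same radius about `F p`. -/
def LocallyIsometricAt {P M : Type*} [MetricSpace M] (d : P → P → ℝ) (F : P → M) (p : P) : Prop :=
  ∃ ε > 0, (∀ q q', d p q < ε → d p q' < ε → dist (F q) (F q') = d q q') ∧
    F '' {q | d p q < ε} = Metric.ball (F p) ε

/-! ### Hyperbolic cone manifolds -/

/-- `M` is a (connected, 3-dimensional) hyperbolic cone manifold with singular locus `S`: a complete
length space `M` with a compact subset `S` such that `M` is locally isometric to hyperbolic 3-space
near points outside `S`, and near points of `S` it is locally isometric to hyperbolic 3-space with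
some cone angle `α > 0` along an axis, with `S` corresponding to the axis.

So `S` is a closed 1-manifold (possibly empty), the cone angle is constant along each of its
components, the hyperbolic metric of `M \ S` is incomplete along `S`, and `M` is its completion. -/
structure IsHyperbolicConeManifold (M : Type*) [MetricSpace M] (S : Set M) : Prop where
  complete : CompleteSpace M
  length_metric : ∀ x y : M, ∀ ε : ℝ, 0 < ε →
    ∃ γ : Path x y, eVariationOn γ univ ≤ ENNReal.ofReal (dist x y + ε)
  isCompact_singular : IsCompact S
  regular : ∀ x ∉ S, ∃ (F : HypSpace → M) (p : HypSpace),
    F p = x ∧ LocallyIsometricAt HypSpace.hdist F p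
  singular : ∀ x ∈ S, ∃ α > 0, ∃ (F : ConePoint → M) (p : ConePoint),
    p.radius = 0 ∧ F p = x ∧ LocallyIsometricAt (ConePoint.cdist α) F p ∧
      ∃ ε > 0, ∀ q, ConePoint.cdist α p q < ε → (F q ∈ S ↔ q.radius = 0)

/-! ### Tubes about the singular locus -/

/-- Two coordinate triples represent the same point of the solid torus with a singular core of
cone angle `α`, core length `ℓ` and twist `t`, i.e. the quotient by
`(ρ, θ, z) ∼ (ρ, θ + α, z)` and `(ρ, θ, z) ∼ (ρ, θ + t, z + ℓ)`. -/
def TubeRel (α ℓ t : ℝ) (p q : ConePoint) : Prop :=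
  p.radius = q.radius ∧
    ∃ m n : ℤ, q.axial = p.axial + n * ℓ ∧ (p.radius = 0 ∨ q.angle = p.angle + m * α + n * t)

/-- The `r`-neighborhood of `S` is an embedded tube of radius `r`: it is a disjoint union of
finitely many solid tori `{ρ < r}` with a singular core, and `S` is the union of the cores. The
`i`-th torus has cone angle `α i`, core length `ℓ i` and twist `t i`, and is parametrized by the
restriction of `F i` to `{ρ < r}`. -/
def HasEmbeddedTube {M : Type*} [MetricSpace M] (S : Set M) (r : ℝ) : Prop :=
  ∃ (n : ℕ) (α ℓ t : Fin n → ℝ) (F : Fin n → ConePoint → M),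
    (∀ i, 0 < α i ∧ 0 < ℓ i) ∧
    (∀ i p, p.radius < r → LocallyIsometricAt (ConePoint.cdist (α i)) (F i) p) ∧
    (∀ i j p q, p.radius < r → q.radius < r →
      (F i p = F j q ↔ i = j ∧ TubeRel (α i) (ℓ i) (t i) p q)) ∧
    (⋃ i, F i '' {p | p.radius < r}) = Metric.thickening r S ∧
    (⋃ i, F i '' {p | p.radius = 0}) = S

/-- The tube radius about `S`: the supremum of the `r > 0` such that the `r`-neighborhood of `S`
is an embedded tube (it is `∞` if `S` is empty). -/
def tubeRadius {M : Type*} [MetricSpace M] (S : Set M) : ENNReal :=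
  ⨆ (r : ℝ) (_ : 0 < r) (_ : HasEmbeddedTube S r), ENNReal.ofReal r

/-! ### Horoball neighborhoods of cusps -/

/-- A horoball neighborhood of a (torus) cusp of a cone manifold with singular locus `S`: an
isometrically embedded copy, in the complement of `S`, of the quotient of the open horoball
`{t > level}` of the upper half-space by a rank two lattice of horizontal translations. The
embedding is given by `param`, of which only the restriction to the horoball matters. -/
structure HoroballNbhd {M : Type*} [MetricSpace M] (S : Set M) where
  level : ℝ
  level_pos : 0 < level
  lattice : Submodule ℤ ℂ
  discrete : DiscreteTopology lattice
  spans : Submodule.span ℝ (lattice : Set ℂ) = ⊤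
  param : HypSpace → M
  locallyIsometric : ∀ p, level < p.height → LocallyIsometricAt HypSpace.hdist param p
  param_eq_iff : ∀ p q, level < p.height → level < q.height →
    (param p = param q ↔ ∃ v ∈ lattice, q = p.translate v)
  param_notMem : ∀ p, level < p.height → param p ∉ S

namespace HoroballNbhd

variable {M : Type*} [MetricSpace M] {S : Set M}

/-- The underlying open subset of `M`. -/
def carrier (U : HoroballNbhd S) : Set M :=
  U.param '' {p | U.level < p.height}

/-- Two horoball neighborhoods belong to the same cusp if one contains the other. -/
def SameCusp (U V : HoroballNbhd S) : Prop :=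
  U.carrier ⊆ V.carrier ∨ V.carrier ⊆ U.carrier

/-- The boundary torus `∂U` is the quotient of the horosphere `{t = level}` by the lattice. A closed
curve on it is given by a lift `c` to the horosphere, whose points are described by their horizontal
coordinate in `ℂ`. The closed curve is homotopically nontrivial iff the lift is not closed, and it
is simple iff no two different times, except the two end times, give equivalent points. -/
def IsNontrivialSimpleClosedCurve (U : HoroballNbhd S) (c : C(unitInterval, ℂ)) : Prop :=
  c 1 - c 0 ∈ U.lattice ∧ c 1 ≠ c 0 ∧
    ∀ s t : unitInterval, s < t → c t - c s ∈ U.lattice → s = 0 ∧ t = 1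

/-- The length of a curve on `∂U`. The metric which the horosphere `{t = level}` inherits from
hyperbolic 3-space is the Euclidean metric of `ℂ` divided by `level`. -/
def curveLength (U : HoroballNbhd S) (c : C(unitInterval, ℂ)) : ENNReal :=
  eVariationOn c univ / ENNReal.ofReal U.level

/-- A meridian of `∂U`: a shortest nontrivial simple closed curve. -/
def IsMeridian (U : HoroballNbhd S) (c : C(unitInterval, ℂ)) : Prop :=
  U.IsNontrivialSimpleClosedCurve c ∧
    ∀ c', U.IsNontrivialSimpleClosedCurve c' → U.curveLength c ≤ U.curveLength c'

end HoroballNbhd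

end

/-!
The parametrization of the given horoball neighborhood is extended downwards, from the horoball
`{t > level}` of the upper half-space to a larger one. Let `v` be a shortest nonzero vector of
the lattice, so that the meridian of the boundary torus at level `l` has length `|v| / l`. The
level `l = |v| / (1 - exp (-2R))` is the one at which this length is `1 - exp (-2R)`, and it is
enough to reach it.

First, the parametrization extends to a local isometry `F` into the complement of the singular
locus, not necessarily injective, on the horoball of level `k = exp (-R) l = |v| / (2 sinh R)`
(`HoroballNbhd.exists_isExtension`). By completeness, an obstruction to extending it below some
level `k' > k` is a point at height `k'` which the limit of `F` maps to the singular locus. The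
same holds for its translate by `v`. The geodesic between the two points has length `2T` with
`sinh T = |v| / (2k') < sinh R`, so its image is a geodesic which starts and ends on the singular
locus and stays within a distance `T < R` of it, hence in an embedded tube. This is impossible,
because the distance to the singular locus is strictly convex along geodesics in the tube
(`ConePoint.radius_lt_of_midpoint`, `HasEmbeddedTube.not_return`,
`HoroballNbhd.IsExtension.limit_notMem`).

Second, `F` is injective modulo the lattice on the horoball of level `l`
(`HoroballNbhd.IsExtension.exists_translate_of_eq`). Otherwise there is an isometry `g` of
hyperbolic space, not a lattice translation, with `F ∘ g = F` wherever both sides are defined,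
such that the horoball of some level `t > l ≥ |v|` meets its image under `g`. As in the proof of
the Shimizu–Leutbecher lemma, `g` is replaced by `g⁻¹ τ g`, where `τ` is the translation by `v`;
this replaces `t` by `t² / |v|`. For `F` to be invariant under the new isometry, `F` has to be
defined at a common point of three horoballs, which is where `k ≤ (√3 / 2) l`, i.e. `R ≥ log (2 /
√3)`, is used. After finitely many steps, `t` exceeds the level of the given horoball
neighborhood, which is embedded: a contradiction.

Both parts rest on the rigidity of local isometries of hyperbolic space: they are determined by
their germ at one point (`HypSpace.eqOn_of_eventuallyEq`), and two germs with the same value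
differ by a global isometry (`HypSpace.exists_isometryEquiv_of_eq`). The latter is linear algebra
in the hyperboloid model.
-/

open Filter Topology

/-! ### Hyperbolic space as a metric space -/

namespace HypSpace

lemma eq_iff_base_height {p q : HypSpace} : p = q ↔ p.base = q.base ∧ p.height = q.height := by
  cases p; cases q; simp

lemma one_le_cosh_arg (p q : HypSpace) :
    1 ≤ 1 + (‖p.base - q.base‖ ^ 2 + (p.height - q.height) ^ 2) /
      (2 * p.height * q.height) := by
  have := p.height_pos
  have := q.height_pos
  have : 0 ≤ (‖p.base - q.base‖ ^ 2 + (p.height - q.height) ^ 2) /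
      (2 * p.height * q.height) := by positivity
  linarith

lemma cosh_hdist (p q : HypSpace) : Real.cosh (p.hdist q) =
    1 + (‖p.base - q.base‖ ^ 2 + (p.height - q.height) ^ 2) / (2 * p.height * q.height) :=
  Real.cosh_arcosh (one_le_cosh_arg p q)

lemma hdist_nonneg (p q : HypSpace) : 0 ≤ p.hdist q :=
  Real.arcosh_nonneg (one_le_cosh_arg p q)

lemma hdist_comm (p q : HypSpace) : p.hdist q = q.hdist p := by
  unfold hdist
  rw [norm_sub_rev]
  ring_nf

lemma hdist_self (p : HypSpace) : p.hdist p = 0 := by simp [hdist]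

/-- The triangle inequality is Cauchy–Schwarz for the components of `p` and `r` orthogonal to `q` in
the hyperboloid model, i.e. for the vectors `(x₁, y₁, z₁)` and `(x₂, y₂, z₂)` below. -/
lemma hdist_triangle (p q r : HypSpace) : p.hdist r ≤ p.hdist q + q.hdist r := by
  have hp := p.height_pos
  have hq := q.height_pos
  have hr := r.height_pos
  have h0 : 0 ≤ p.hdist q + q.hdist r := add_nonneg (hdist_nonneg _ _) (hdist_nonneg _ _)
  rw [← abs_of_nonneg h0, ← abs_of_nonneg (hdist_nonneg p r), ← Real.cosh_le_cosh, Real.cosh_add]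
  set x₁ := (p.base - q.base).re / p.height with hx₁
  set y₁ := (p.base - q.base).im / p.height with hy₁
  set z₁ := (‖p.base - q.base‖ ^ 2 + p.height ^ 2 - q.height ^ 2) / (2 * p.height * q.height)
    with hz₁
  set x₂ := (r.base - q.base).re / r.height with hx₂
  set y₂ := (r.base - q.base).im / r.height with hy₂
  set z₂ := (‖r.base - q.base‖ ^ 2 + r.height ^ 2 - q.height ^ 2) / (2 * r.height * q.height)
    with hz₂
  have e1 : x₁ ^ 2 + y₁ ^ 2 + z₁ ^ 2 = Real.sinh (p.hdist q) ^ 2 := by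
    rw [Real.sinh_sq, cosh_hdist, hx₁, hy₁, hz₁, Complex.sq_norm, Complex.normSq_apply]
    field_simp
    ring
  have e2 : x₂ ^ 2 + y₂ ^ 2 + z₂ ^ 2 = Real.sinh (q.hdist r) ^ 2 := by
    rw [hdist_comm, Real.sinh_sq, cosh_hdist, hx₂, hy₂, hz₂, Complex.sq_norm, Complex.normSq_apply]
    field_simp
    ring
  have e3 : Real.cosh (p.hdist r) =
      Real.cosh (p.hdist q) * Real.cosh (q.hdist r) - (x₁ * x₂ + y₁ * y₂ + z₁ * z₂) := by
    rw [hdist_comm q r, cosh_hdist, cosh_hdist, cosh_hdist, hx₁, hy₁, hz₁, hx₂, hy₂, hz₂]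
    simp only [Complex.sq_norm, Complex.normSq_apply, Complex.sub_re, Complex.sub_im]
    field_simp
    ring
  have s1 : 0 ≤ Real.sinh (p.hdist q) := Real.sinh_nonneg_iff.2 (hdist_nonneg _ _)
  have s2 : 0 ≤ Real.sinh (q.hdist r) := Real.sinh_nonneg_iff.2 (hdist_nonneg _ _)
  have cs : -(x₁ * x₂ + y₁ * y₂ + z₁ * z₂) ≤ Real.sinh (p.hdist q) * Real.sinh (q.hdist r) := by
    apply le_of_sq_le_sq _ (mul_nonneg s1 s2)
    rw [mul_pow, ← e1, ← e2]
    nlinarith [sq_nonneg (x₁ * y₂ - y₁ * x₂), sq_nonneg (x₁ * z₂ - z₁ * x₂),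
      sq_nonneg (y₁ * z₂ - z₁ * y₂)]
  rw [e3]
  linarith

lemma eq_of_hdist_eq_zero {p q : HypSpace} (h : p.hdist q = 0) : p = q := by
  have hc := cosh_hdist p q
  have hp := p.height_pos
  have hq := q.height_pos
  rw [h, Real.cosh_zero, left_eq_add, div_eq_zero_iff] at hc
  have h2 : ‖p.base - q.base‖ ^ 2 + (p.height - q.height) ^ 2 = 0 :=
    hc.resolve_right (by positivity)
  have h3 : ‖p.base - q.base‖ ^ 2 = 0 := by
    nlinarith [sq_nonneg (p.height - q.height), sq_nonneg ‖p.base - q.base‖]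
  have h4 : (p.height - q.height) ^ 2 = 0 := by linarith
  refine eq_iff_base_height.2 ⟨?_, ?_⟩
  · simpa [sub_eq_zero] using h3
  · simpa [sub_eq_zero] using h4

noncomputable instance : MetricSpace HypSpace where
  dist := hdist
  dist_self := hdist_self
  dist_comm := hdist_comm
  dist_triangle := hdist_triangle
  eq_of_dist_eq_zero := eq_of_hdist_eq_zero

lemma dist_def (p q : HypSpace) : dist p q = p.hdist q := rfl

lemma cosh_dist (p q : HypSpace) : Real.cosh (dist p q) =
    (‖p.base - q.base‖ ^ 2 + p.height ^ 2 + q.height ^ 2) / (2 * p.height * q.height) := by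
  have := p.height_pos
  have := q.height_pos
  rw [dist_def, cosh_hdist]
  field_simp
  ring

lemma dist_eq_of_cosh_eq {p q : HypSpace} {d : ℝ} (hd : 0 ≤ d)
    (h : (‖p.base - q.base‖ ^ 2 + p.height ^ 2 + q.height ^ 2) / (2 * p.height * q.height) =
      Real.cosh d) : dist p q = d := by
  rw [← cosh_dist] at h
  exact Real.cosh_injOn dist_nonneg hd h

lemma dist_lt_iff {p q : HypSpace} {d : ℝ} (hd : 0 ≤ d) : dist p q < d ↔
    ‖p.base - q.base‖ ^ 2 + p.height ^ 2 + q.height ^ 2 <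
      Real.cosh d * (2 * p.height * q.height) := by
  have := p.height_pos
  have := q.height_pos
  rw [← div_lt_iff₀ (by positivity), ← cosh_dist, Real.cosh_lt_cosh, abs_of_nonneg hd,
    abs_of_nonneg dist_nonneg]

lemma abs_log_height_sub_le (p q : HypSpace) :
    |Real.log p.height - Real.log q.height| ≤ dist p q := by
  have hp := p.height_pos
  have hq := q.height_pos
  rw [← abs_of_nonneg (dist_nonneg : 0 ≤ dist p q), ← Real.cosh_le_cosh, cosh_dist, Real.cosh_eq,
    neg_sub, Real.exp_sub, Real.exp_sub, Real.exp_log hp, Real.exp_log hq,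
    le_div_iff₀ (by positivity)]
  have : (p.height / q.height + q.height / p.height) / 2 * (2 * p.height * q.height) =
    p.height ^ 2 + q.height ^ 2 := by field_simp
  rw [this]
  nlinarith [sq_nonneg (‖p.base - q.base‖)]

lemma continuous_height : Continuous height := by
  have h : LipschitzWith 1 fun p : HypSpace => Real.log p.height :=
    LipschitzWith.of_dist_le_mul fun p q => by
      simpa [Real.dist_eq] using abs_log_height_sub_le p q
  refine (Real.continuous_exp.comp h.continuous).congr fun p => ?_
  simp [Real.exp_log p.height_pos]

lemma continuous_base : Continuous base := by
  rw [continuous_iff_continuousAt]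
  intro p
  rw [ContinuousAt, tendsto_iff_norm_sub_tendsto_zero]
  have h1 : Tendsto (fun q : HypSpace => Real.sqrt
      (Real.cosh (dist q p) * (2 * q.height * p.height) - q.height ^ 2 - p.height ^ 2)) (𝓝 p)
      (𝓝 0) := by
    have : Continuous (fun q : HypSpace => Real.sqrt
      (Real.cosh (dist q p) * (2 * q.height * p.height) - q.height ^ 2 - p.height ^ 2)) := by
      have := continuous_height
      have := Real.continuous_cosh
      fun_prop
    have h2 := this.tendsto p
    simp only [dist_self, Real.cosh_zero] at h2
    convert h2
    ring_nf
    simp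
  refine h1.congr fun q => ?_
  have hp := p.height_pos
  have hq := q.height_pos
  rw [cosh_dist, div_mul_cancel₀ _ (by positivity)]
  ring_nf
  exact Real.sqrt_sq (norm_nonneg _)

/-- Hyperbolic space carries the product topology of `ℂ × (0, ∞)`. -/
lemma continuous_mk {X : Type*} [TopologicalSpace X] {f : X → ℂ} {g : X → ℝ} (hf : Continuous f)
    (hg : Continuous g) (h : ∀ x, 0 < g x) : Continuous fun x => HypSpace.mk (f x) (g x) (h x) := by
  rw [continuous_iff_continuousAt]
  intro x
  rw [ContinuousAt, tendsto_iff_dist_tendsto_zero]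
  simp only [dist_def, hdist]
  have h1 : Continuous fun y => 1 + (‖f y - f x‖ ^ 2 + (g y - g x) ^ 2) / (2 * g y * g x) := by
    have : ∀ y, 2 * g y * g x ≠ 0 := fun y => by have := h y; have := h x; positivity
    fun_prop (disch := assumption)
  have h2 := Real.continuousOn_arcosh.comp_continuous h1
    (fun y => one_le_cosh_arg ⟨f y, g y, h y⟩ ⟨f x, g x, h x⟩)
  have h3 := h2.tendsto x
  simpa [Function.comp_def] using h3

/-- A set of points which is convex in the Euclidean sense is preconnected. -/
lemma isPreconnected_of_convex (s : Set HypSpace)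
    (hs : Convex ℝ ((fun p : HypSpace => (p.base, p.height)) '' s)) : IsPreconnected s := by
  have h1 := hs.isPreconnected
  have h2 : ∀ x ∈ ((fun p : HypSpace => (p.base, p.height)) '' s), 0 < x.2 := by
    rintro _ ⟨p, -, rfl⟩
    exact p.height_pos
  have h3 := isPreconnected_iff_preconnectedSpace.1 h1
  have h4 := isPreconnected_range (continuous_mk
    (X := ((fun p : HypSpace => (p.base, p.height)) '' s))
    (f := fun x => x.1.1) (g := fun x => x.1.2) (by fun_prop) (by fun_prop) (fun x => h2 x.1 x.2))
  convert h4
  ext p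
  constructor
  · intro hp
    exact ⟨⟨_, p, hp, rfl⟩, rfl⟩
  · rintro ⟨⟨_, q, hq, rfl⟩, rfl⟩
    exact hq

/-- Horoballs and metric balls of the upper half-space are given by inequalities of the form `α
(|w - w₀|² + s²) + β < γ s` with `α ≥ 0`, so the intersection of any two of them is preconnected.
-/
lemma isPreconnected_setOf_and {α α' : ℝ} (hα : 0 ≤ α) (hα' : 0 ≤ α') (β β' γ γ' : ℝ) (w w' : ℂ) :
    IsPreconnected {p : HypSpace | α * (‖p.base - w‖ ^ 2 + p.height ^ 2) + β < γ * p.height ∧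
      α' * (‖p.base - w'‖ ^ 2 + p.height ^ 2) + β' < γ' * p.height} := by
  have conv : ∀ {α : ℝ}, 0 ≤ α → ∀ (β γ : ℝ) (w : ℂ),
      Convex ℝ {x : ℂ × ℝ | α * (‖x.1 - w‖ ^ 2 + x.2 ^ 2) + β < γ * x.2} := by
    intro α hα β γ w
    have n1 : ConvexOn ℝ univ fun x : ℂ × ℝ => ‖x.1 - w‖ ^ 2 := by
      refine ConvexOn.pow (f := fun x : ℂ × ℝ => ‖x.1 - w‖) ?_ (fun _ _ => norm_nonneg _) 2
      refine ⟨convex_univ, fun x _ y _ a b ha hb hab => ?_⟩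
      have : (a • x + b • y).1 - w = a • (x.1 - w) + b • (y.1 - w) := by
        have hw : w = (a + b) • w := by rw [hab, one_smul]
        conv_lhs => rw [hw]
        simp only [Prod.fst_add, Prod.smul_fst]
        module
      change ‖(a • x + b • y).1 - w‖ ≤ a • ‖x.1 - w‖ + b • ‖y.1 - w‖
      rw [this]
      refine (norm_add_le _ _).trans ?_
      simp [abs_of_nonneg ha, abs_of_nonneg hb]
    have n2 : ConvexOn ℝ univ fun x : ℂ × ℝ => x.2 ^ 2 := by
      have := (even_two.convexOn_pow (𝕜 := ℝ)).comp_linearMap (LinearMap.snd ℝ ℂ ℝ)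
      simpa [Function.comp_def] using this
    have n3 : ConvexOn ℝ univ fun x : ℂ × ℝ => -γ * x.2 :=
      ⟨convex_univ, fun x _ y _ a b ha hb hab => by
        simp only [Prod.snd_add, Prod.smul_snd, smul_eq_mul]
        apply le_of_eq
        ring⟩
    have n4 := ((((n1.add n2).smul hα).add_const β).add n3).convex_lt 0
    have e : {x : ℂ × ℝ | α * (‖x.1 - w‖ ^ 2 + x.2 ^ 2) + β < γ * x.2} =
        {x | x ∈ univ ∧ α * (‖x.1 - w‖ ^ 2 + x.2 ^ 2) + β + -γ * x.2 < 0} := by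
      ext x
      simp only [mem_ofPred_eq, mem_univ, true_and]
      constructor <;> intro h <;> linarith
    rw [e]
    exact n4
  apply isPreconnected_of_convex
  convert ((conv hα β γ w).inter (conv hα' β' γ' w')).inter
    (convex_halfSpace_gt (LinearMap.snd ℝ ℂ ℝ).isLinear 0) using 1
  ext x
  constructor
  · rintro ⟨p, hp, rfl⟩
    exact ⟨hp, p.height_pos⟩
  · rintro ⟨hx, hx'⟩
    exact ⟨⟨x.1, x.2, hx'⟩, hx, rfl⟩

lemma isPreconnected_setOf_lt_height (k : ℝ) : IsPreconnected {p : HypSpace | k < p.height} := by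
  simpa using isPreconnected_setOf_and le_rfl le_rfl k k 1 1 0 0

lemma isOpen_setOf_lt_height (k : ℝ) : IsOpen {p : HypSpace | k < p.height} :=
  isOpen_lt continuous_const continuous_height

lemma ball_eq (p : HypSpace) {r : ℝ} (hr : 0 ≤ r) : Metric.ball p r =
    {q | 1 * (‖q.base - p.base‖ ^ 2 + q.height ^ 2) + p.height ^ 2 <
      (Real.cosh r * 2 * p.height) * q.height} := by
  ext q
  rw [Metric.mem_ball, dist_lt_iff hr]
  simp only [mem_ofPred_eq]
  constructor <;> intro h <;> linarith

lemma isPreconnected_ball_inter_ball (p p' : HypSpace) (r r' : ℝ) :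
    IsPreconnected (Metric.ball p r ∩ Metric.ball p' r') := by
  rcases lt_or_ge r 0 with h | h
  · simp [Metric.ball_eq_empty.2 h.le, isPreconnected_empty]
  rcases lt_or_ge r' 0 with h' | h'
  · simp [Metric.ball_eq_empty.2 h'.le, isPreconnected_empty]
  rw [ball_eq _ h, ball_eq _ h']
  exact isPreconnected_setOf_and zero_le_one zero_le_one _ _ _ _ _ _

lemma isPreconnected_ball_inter_setOf_lt_height (p : HypSpace) (r k : ℝ) :
    IsPreconnected (Metric.ball p r ∩ {q | k < q.height}) := by
  rcases lt_or_ge r 0 with h | h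
  · simp [Metric.ball_eq_empty.2 h.le, isPreconnected_empty]
  rw [ball_eq _ h]
  convert isPreconnected_setOf_and zero_le_one le_rfl (p.height ^ 2) k
    (Real.cosh r * 2 * p.height) 1 p.base 0 using 1
  ext q
  simp

/-- Near any point there are four points in general position, obtained by moving the given one in
the coordinate directions. -/
lemma exists_frame {O : Set HypSpace} (hO : IsOpen O) {b : HypSpace} (hb : b ∈ O) :
    ∃ (η : ℝ) (hη : 0 < η), (⟨b.base, b.height + η, add_pos b.height_pos hη⟩ : HypSpace) ∈ O ∧
      (⟨b.base + η, b.height, b.height_pos⟩ : HypSpace) ∈ O ∧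
      (⟨b.base + η * Complex.I, b.height, b.height_pos⟩ : HypSpace) ∈ O := by
  have c1 : Continuous fun η : ℝ => (⟨b.base, b.height + |η|,
      add_pos_of_pos_of_nonneg b.height_pos (abs_nonneg η)⟩ : HypSpace) :=
    continuous_mk (by fun_prop) (by fun_prop) _
  have c2 : Continuous fun η : ℝ => (⟨b.base + η, b.height, b.height_pos⟩ : HypSpace) :=
    continuous_mk (by fun_prop) (by fun_prop) _
  have c3 : Continuous fun η : ℝ => (⟨b.base + η * Complex.I, b.height, b.height_pos⟩ : HypSpace) :=
    continuous_mk (by fun_prop) (by fun_prop) _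
  have e1 := (c1.tendsto 0).eventually_mem (hO.mem_nhds (by simpa using hb))
  have e2 := (c2.tendsto 0).eventually_mem (hO.mem_nhds (by simpa using hb))
  have e3 := (c3.tendsto 0).eventually_mem (hO.mem_nhds (by simpa using hb))
  obtain ⟨η, ⟨h1, h2, h3⟩, hη⟩ := ((((e1.and (e2.and e3)).filter_mono
    (nhdsWithin_le_nhds (s := Ioi 0))).and self_mem_nhdsWithin).exists)
  have hη : 0 < η := hη
  refine ⟨η, hη, ?_, h2, h3⟩
  simpa [abs_of_pos hη] using h1

end HypSpace

/-! ### The hyperboloid model and rigidity of isometries -/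

namespace HypSpace

/-- The vector of the hyperboloid model corresponding to a point of the upper half-space, in light
cone coordinates: Minkowski space is `ℝ × ℝ × ℂ` with the quadratic form `(a, b, c) ↦ a b - |c|²`.
-/
noncomputable def toVec (p : HypSpace) : ℝ × ℝ × ℂ :=
  (1 / p.height, (‖p.base‖ ^ 2 + p.height ^ 2) / p.height, (1 / p.height : ℝ) • p.base)

/-- The Minkowski form on `ℝ × ℝ × ℂ`, with associated quadratic form `(a, b, c) ↦ a b - |c|²`. -/
noncomputable def minkowski : (ℝ × ℝ × ℂ) →ₗ[ℝ] (ℝ × ℝ × ℂ) →ₗ[ℝ] ℝ :=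
  LinearMap.mk₂ ℝ (fun x y => (x.1 * y.2.1 + x.2.1 * y.1) / 2 -
      (x.2.2.re * y.2.2.re + x.2.2.im * y.2.2.im))
    (fun x x' y => by simp; ring) (fun c x y => by simp; ring)
    (fun x y y' => by simp; ring) (fun c x y => by simp; ring)

lemma minkowski_apply (x y : ℝ × ℝ × ℂ) : minkowski x y = (x.1 * y.2.1 + x.2.1 * y.1) / 2 -
    (x.2.2.re * y.2.2.re + x.2.2.im * y.2.2.im) := rfl

lemma minkowski_toVec (p q : HypSpace) : minkowski p.toVec q.toVec = Real.cosh (dist p q) := by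
  have := p.height_pos
  have := q.height_pos
  rw [cosh_dist, minkowski_apply]
  simp only [toVec, Complex.sq_norm, Complex.normSq_apply, Complex.sub_re, Complex.sub_im,
    Complex.smul_re, Complex.smul_im, smul_eq_mul]
  field_simp
  ring

lemma toVec_injective : Function.Injective toVec := by
  intro p q h
  have h1 := minkowski_toVec p q
  rw [h, minkowski_toVec, dist_self, Real.cosh_zero] at h1
  have : Real.cosh 0 = Real.cosh (dist p q) := by rw [Real.cosh_zero, h1]
  exact dist_eq_zero.1 (Real.cosh_injOn self_mem_Ici dist_nonneg this).symm

/-- The hyperboloid model is the upper sheet of the unit hyperboloid. -/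
lemma exists_toVec_eq {x : ℝ × ℝ × ℂ} (hx : minkowski x x = 1) (hx0 : 0 < x.1) :
    ∃ p : HypSpace, p.toVec = x := by
  obtain ⟨a, b, c⟩ := x
  simp only at hx0
  rw [minkowski_apply] at hx
  simp only at hx
  refine ⟨⟨(1 / a : ℝ) • c, 1 / a, by positivity⟩, ?_⟩
  simp only [toVec, Prod.mk.injEq]
  refine ⟨by simp, ?_, ?_⟩
  · have : ‖(1 / a : ℝ) • c‖ ^ 2 = (1 / a) ^ 2 * (c.re * c.re + c.im * c.im) := by
      rw [norm_smul, mul_pow, Complex.sq_norm, Complex.normSq_apply, Real.norm_eq_abs, sq_abs]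
    rw [this]
    field_simp
    linarith
  · rw [smul_smul, one_div_one_div, mul_one_div_cancel hx0.ne', one_smul]

/-- Two unit timelike vectors with positive product belong to the same sheet of the hyperboloid. -/
lemma fst_pos_of_minkowski_pos {x : ℝ × ℝ × ℂ} (hx : minkowski x x = 1) (p : HypSpace)
    (h : 0 < minkowski x p.toVec) : 0 < x.1 := by
  by_contra! hneg
  have hp := minkowski_toVec p p
  have hp1 : 0 < p.toVec.1 := one_div_pos.2 p.height_pos
  rw [dist_self, Real.cosh_zero] at hp
  obtain ⟨a, b, c⟩ := x
  generalize p.toVec = y at *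
  obtain ⟨a', b', c'⟩ := y
  simp only [minkowski_apply] at *
  have hab : 0 < a * b := by nlinarith [mul_self_nonneg c.re, mul_self_nonneg c.im]
  have ha : a < 0 := lt_of_le_of_ne hneg (by rintro rfl; simp at hab)
  have hb : b < 0 := by nlinarith
  have hb' : 0 < b' := by nlinarith [mul_self_nonneg c'.re, mul_self_nonneg c'.im]
  -- the reversed Cauchy–Schwarz inequality
  have h1 : (c.re * c'.re + c.im * c'.im) ^ 2 ≤ (a * b - 1) * (a' * b' - 1) := by
    have e1 : a * b - 1 = c.re * c.re + c.im * c.im := by linarith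
    have e2 : a' * b' - 1 = c'.re * c'.re + c'.im * c'.im := by linarith
    rw [e1, e2]
    nlinarith [sq_nonneg (c.re * c'.im - c.im * c'.re)]
  have h2 : (a * b - 1) * (a' * b' - 1) < (a * b) * (a' * b') := by
    nlinarith [mul_self_nonneg c'.re, mul_self_nonneg c'.im, mul_pos hp1 hb']
  have h3 : (a * b) * (a' * b') ≤ ((a * b' + b * a') / 2) ^ 2 := by
    nlinarith [sq_nonneg (a * b' - b * a')]
  have h4 : (a * b' + b * a') / 2 < 0 := by
    nlinarith [mul_pos (neg_pos.2 ha) hb', mul_pos (neg_pos.2 hb) hp1]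
  have h5 := abs_lt_of_sq_lt_sq ((h1.trans_lt (h2.trans_le h3)).trans_eq (neg_sq _).symm)
    (by linarith : 0 ≤ -((a * b' + b * a') / 2))
  linarith [neg_abs_le (c.re * c'.re + c.im * c'.im)]

/-- The vectors of a frame of four points, as a family indexed by `Fin 4`. -/
noncomputable def frameVec (b : HypSpace) (η : ℝ) (hη : 0 < η) : Fin 4 → ℝ × ℝ × ℂ :=
  ![b.toVec, toVec ⟨b.base, b.height + η, add_pos b.height_pos hη⟩,
    toVec ⟨b.base + η, b.height, b.height_pos⟩,
    toVec ⟨b.base + η * Complex.I, b.height, b.height_pos⟩]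

lemma linearIndependent_frameVec (b : HypSpace) (η : ℝ) (hη : 0 < η) :
    LinearIndependent ℝ (frameVec b η hη) := by
  rw [Fintype.linearIndependent_iff]
  intro c hc
  have hb := b.height_pos
  have hb' : 0 < b.height + η := by positivity
  simp only [Fin.sum_univ_four, frameVec, toVec, Prod.ext_iff, Complex.ext_iff] at hc
  simp [Complex.sq_norm, Complex.normSq_apply] at hc
  obtain ⟨h1, h2, h3, h4⟩ := hc
  field_simp at h1 h2 h3 h4
  have k2 : c 2 = 0 := by
    have : c 2 * η * (b.height + η) = 0 := by linear_combination h3 - b.base.re * h1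
    simpa [hη.ne', hb'.ne'] using this
  have k3 : c 3 = 0 := by
    have : c 3 * η * (b.height + η) = 0 := by linear_combination h4 - b.base.im * h1
    simpa [hη.ne', hb'.ne'] using this
  rw [k2, k3] at h1 h2
  have k0 : c 0 = 0 := by
    have : c 0 * (b.height + η) * ((b.height + η) * (b.height + η) - b.height * b.height) = 0 := by
      linear_combination ((b.base.re ^ 2 + b.base.im ^ 2 + (b.height + η)^2) * h1 - h2)
    have h : (b.height + η) * (b.height + η) - b.height * b.height ≠ 0 := by nlinarith
    simpa [h, hb'.ne'] using this
  have k1 : c 1 = 0 := by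
    rw [k0] at h1
    have : c 1 * b.height = 0 := by linear_combination h1
    simpa [hb.ne'] using this
  intro i
  fin_cases i <;> assumption

/-- A point of hyperbolic space is determined by its distances to the points of a nonempty open
set. -/
lemma eq_of_forall_dist_eq {O : Set HypSpace} (hO : IsOpen O) {b : HypSpace} (hb : b ∈ O)
    {y z : HypSpace} (h : ∀ x ∈ O, dist y x = dist z x) : y = z := by
  obtain ⟨η, hη, h1, h2, h3⟩ := exists_frame hO hb
  let B := basisOfLinearIndependentOfCardEqFinrank (linearIndependent_frameVec b η hη) (by simp)
  have key : minkowski (y.toVec) = minkowski (z.toVec) := by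
    apply B.ext
    intro i
    have : ∀ x ∈ O, minkowski y.toVec x.toVec = minkowski z.toVec x.toVec := fun x hx => by
      rw [minkowski_toVec, minkowski_toVec, h x hx]
    rw [coe_basisOfLinearIndependentOfCardEqFinrank]
    fin_cases i
    exacts [this _ hb, this _ h1, this _ h2, this _ h3]
  have h4 := congrArg (fun f => f z.toVec) key
  simp only [minkowski_toVec, dist_self] at h4
  exact dist_eq_zero.1 (Real.cosh_injOn dist_nonneg self_mem_Ici h4)

lemma eq_zero_of_minkowski_eq_zero {x : ℝ × ℝ × ℂ} (h : minkowski x = 0) : x = 0 := by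
  have h1 := congrArg (fun f => f (1, 0, 0)) h
  have h2 := congrArg (fun f => f (0, 1, 0)) h
  have h3 := congrArg (fun f => f (0, 0, 1)) h
  have h4 := congrArg (fun f => f (0, 0, Complex.I)) h
  simp [minkowski_apply] at h1 h2 h3 h4
  exact Prod.ext h2 (Prod.ext h1 (Complex.ext h3 h4))

/-- A linear Lorentz transformation which maps some point of the upper sheet of the hyperboloid to
the upper sheet induces an isometry of hyperbolic space. -/
lemma exists_isometryEquiv_of_linearEquiv (L : (ℝ × ℝ × ℂ) ≃ₗ[ℝ] ℝ × ℝ × ℂ)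
    (hL : ∀ x y, minkowski (L x) (L y) = minkowski x y) (b b' : HypSpace)
    (hb : L b.toVec = b'.toVec) :
    ∃ g : HypSpace ≃ᵢ HypSpace, ∀ x, (g x).toVec = L x.toVec := by
  have pos : ∀ p q : HypSpace, 0 < minkowski p.toVec q.toVec := fun p q => by
    rw [minkowski_toVec]
    exact Real.cosh_pos _
  have one : ∀ p : HypSpace, minkowski p.toVec p.toVec = 1 := fun p => by simp [minkowski_toVec]
  have hex : ∀ x : HypSpace, ∃ y : HypSpace, y.toVec = L x.toVec := fun x => by
    have h1 : minkowski (L x.toVec) (L x.toVec) = 1 := by rw [hL, one]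
    refine exists_toVec_eq h1 (fst_pos_of_minkowski_pos h1 b' ?_)
    rw [← hb, hL]
    exact pos _ _
  have hex' : ∀ x : HypSpace, ∃ y : HypSpace, L y.toVec = x.toVec := fun x => by
    have h1 : minkowski (L.symm x.toVec) (L.symm x.toVec) = 1 := by
      rw [← hL, L.apply_symm_apply, one]
    obtain ⟨y, hy⟩ := exists_toVec_eq h1 (fst_pos_of_minkowski_pos h1 b (by
      rw [← hL, hb, L.apply_symm_apply]
      exact pos _ _))
    exact ⟨y, by rw [hy, L.apply_symm_apply]⟩
  choose f hf using hex
  choose f' hf' using hex'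
  refine ⟨IsometryEquiv.mk' f f' (fun x => toVec_injective (by rw [hf, hf'])) ?_, hf⟩
  refine Isometry.of_dist_eq fun x y => ?_
  apply Real.cosh_injOn dist_nonneg dist_nonneg
  rw [← minkowski_toVec, ← minkowski_toVec, hf, hf, hL]

/-- The horospheres of the isometry `g`: either `g` fixes the point `∞`, or the images under `g⁻¹`
of the horoballs at `∞` are the horoballs at another point `w₀`. -/
lemma height_formula_of_linearEquiv (L : (ℝ × ℝ × ℂ) ≃ₗ[ℝ] ℝ × ℝ × ℂ)
    (hL : ∀ x y, minkowski (L x) (L y) = minkowski x y) (g : HypSpace → HypSpace)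
    (hg : ∀ x, (g x).toVec = L x.toVec) :
    (∃ μ > 0, ∀ x, (g x).height = μ * x.height) ∨
    ∃ C > 0, ∃ w₀ : ℂ, ∀ x, (g x).height * (‖x.base - w₀‖ ^ 2 + x.height ^ 2) = C * x.height := by
  -- the first light cone coordinate is the pairing with the null vector `(0, 2, 0)`
  obtain ⟨a, b, c, hn⟩ : ∃ a b c, L.symm (0, 2, 0) = (a, b, c) := ⟨_, _, _, rfl⟩
  have h0 : a * b = c.re ^ 2 + c.im ^ 2 := by
    have := hL (L.symm (0, 2, 0)) (L.symm (0, 2, 0))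
    rw [L.apply_symm_apply, hn] at this
    simp [minkowski_apply] at this
    linarith
  have h1 : ∀ x : HypSpace, 2 * x.height = (g x).height *
      (a * (‖x.base‖ ^ 2 + x.height ^ 2) + b - 2 * (c.re * x.base.re + c.im * x.base.im)) := by
    intro x
    have e1 : minkowski (L.symm (0, 2, 0)) x.toVec = (L x.toVec).1 := by
      rw [← hL, L.apply_symm_apply]
      simp [minkowski_apply]
    rw [← hg, hn] at e1
    have := x.height_pos
    have := (g x).height_pos
    simp [minkowski_apply, toVec] at e1
    field_simp at e1
    linarith
  by_cases ha : a = 0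
  · left
    subst ha
    have hcr : c.re = 0 := by nlinarith [sq_nonneg c.re, sq_nonneg c.im]
    have hci : c.im = 0 := by nlinarith [sq_nonneg c.re, sq_nonneg c.im]
    simp only [hcr, hci] at h1
    have hb : 0 < b := by
      have := h1 ⟨0, 1, one_pos⟩
      simp at this
      by_contra! hb
      nlinarith [(g ⟨0, 1, one_pos⟩).height_pos]
    refine ⟨2 / b, by positivity, fun x => ?_⟩
    have := h1 x
    field_simp
    linarith
  · right
    have key : ∀ x : HypSpace, 2 * x.height = (g x).height *
        (a * (‖x.base - (1 / a : ℝ) • c‖ ^ 2 + x.height ^ 2)) := by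
      intro x
      rw [h1 x]
      congr 1
      simp only [Complex.sq_norm, Complex.normSq_apply, Complex.sub_re, Complex.sub_im,
        Complex.smul_re, Complex.smul_im, smul_eq_mul]
      field_simp
      linear_combination h0
    have ha' : 0 < a := by
      have h2 := key ⟨0, 1, one_pos⟩
      by_contra! hneg
      have h3 := mul_nonneg (g ⟨0, 1, one_pos⟩).height_pos.le
        (add_nonneg (sq_nonneg (‖(0 : ℂ) - (1 / a : ℝ) • c‖)) (sq_nonneg (1 : ℝ)))
      nlinarith
    refine ⟨2 / a, by positivity, (1 / a : ℝ) • c, fun x => ?_⟩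
    have := key x
    field_simp
    linarith

/-- A distance preserving map from a ball to hyperbolic space extends to an isometry of hyperbolic
space, given by a linear map in the hyperboloid model. -/
lemma exists_linearEquiv_of_dist_eq {p : HypSpace} {ε : ℝ} (hε : 0 < ε) {ψ : HypSpace → HypSpace}
    (hψ : ∀ x ∈ Metric.ball p ε, ∀ y ∈ Metric.ball p ε, dist (ψ x) (ψ y) = dist x y) :
    ∃ (L : (ℝ × ℝ × ℂ) ≃ₗ[ℝ] ℝ × ℝ × ℂ) (g : HypSpace ≃ᵢ HypSpace),
      (∀ x y, minkowski (L x) (L y) = minkowski x y) ∧ (∀ x, (g x).toVec = L x.toVec) ∧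
      ∀ x ∈ Metric.ball p ε, g x = ψ x := by
  have hp := Metric.mem_ball_self (x := p) hε
  obtain ⟨η, hη, h1, h2, h3⟩ := exists_frame Metric.isOpen_ball hp
  let B := basisOfLinearIndependentOfCardEqFinrank (linearIndependent_frameVec p η hη) (by simp)
  obtain ⟨P, hPO, hP⟩ : ∃ P : Fin 4 → HypSpace, (∀ i, P i ∈ Metric.ball p ε) ∧
      ∀ i, B i = (P i).toVec := by
    refine ⟨![p, ⟨p.base, p.height + η, add_pos p.height_pos hη⟩,
      ⟨p.base + η, p.height, p.height_pos⟩, ⟨p.base + η * Complex.I, p.height, p.height_pos⟩],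
      fun i => ?_, fun i => ?_⟩
    · fin_cases i
      exacts [hp, h1, h2, h3]
    · rw [coe_basisOfLinearIndependentOfCardEqFinrank]
      fin_cases i <;> rfl
  let L₀ : (ℝ × ℝ × ℂ) →ₗ[ℝ] ℝ × ℝ × ℂ := B.constr ℝ fun i => (ψ (P i)).toVec
  have hL₀ : ∀ i, L₀ (B i) = (ψ (P i)).toVec := fun i => B.constr_basis ℝ _ i
  have hgram : minkowski.compl₁₂ L₀ L₀ = minkowski := by
    refine B.ext fun i => B.ext fun j => ?_
    rw [LinearMap.compl₁₂_apply, hL₀, hL₀, hP, hP, minkowski_toVec, minkowski_toVec,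
      hψ _ (hPO i) _ (hPO j)]
  have hinj : Function.Injective L₀ := by
    rw [← LinearMap.ker_eq_bot, LinearMap.ker_eq_bot']
    intro x hx
    apply eq_zero_of_minkowski_eq_zero
    rw [← hgram]
    ext y <;> simp [LinearMap.compl₁₂_apply, hx]
  let L := LinearEquiv.ofInjectiveEndo L₀ hinj
  have hL : ∀ x y, minkowski (L x) (L y) = minkowski x y := fun x y => by
    conv_rhs => rw [← hgram]
    rfl
  obtain ⟨g, hg⟩ := exists_isometryEquiv_of_linearEquiv L hL (P 0) (ψ (P 0))
    (by rw [← hP]; exact hL₀ 0)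
  refine ⟨L, g, hL, hg, fun x hx => ?_⟩
  have hB : minkowski (g x).toVec = minkowski (ψ x).toVec := by
    refine (B.map L).ext fun i => ?_
    have e : L (B i) = (ψ (P i)).toVec := hL₀ i
    rw [Module.Basis.map_apply, hg, hL, e, minkowski_toVec, hψ _ hx _ (hPO i), hP, minkowski_toVec]
  have h4 := congrArg (fun f => f (ψ x).toVec) hB
  simp only [minkowski_toVec, dist_self] at h4
  exact dist_eq_zero.1 (Real.cosh_injOn dist_nonneg self_mem_Ici h4)

theorem exists_isometryEquiv_of_dist_eq {p : HypSpace} {ε : ℝ} (hε : 0 < ε)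
    {ψ : HypSpace → HypSpace}
    (hψ : ∀ x ∈ Metric.ball p ε, ∀ y ∈ Metric.ball p ε, dist (ψ x) (ψ y) = dist x y) :
    ∃ g : HypSpace ≃ᵢ HypSpace, ∀ x ∈ Metric.ball p ε, g x = ψ x :=
  let ⟨_, g, _, _, hg⟩ := exists_linearEquiv_of_dist_eq hε hψ
  ⟨g, hg⟩

/-- Isometries which agree on a nonempty open set are equal. -/
lemma isometryEquiv_ext {g g' : HypSpace ≃ᵢ HypSpace} {p : HypSpace} (h : g =ᶠ[𝓝 p] g') (x) :
    g x = g' x := by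
  obtain ⟨O, hO, hOo, hpO⟩ := eventually_nhds_iff.1 h
  apply g.symm.injective
  rw [g.symm_apply_apply]
  refine eq_of_forall_dist_eq hOo hpO fun y hy => ?_
  rw [← g'.dist_eq x y, ← g.dist_eq (g.symm (g' x)), g.apply_symm_apply, hO y hy]

/-- An isometry either fixes the point `∞`, or it pulls back the horoballs at `∞` to the horoballs
at another point `w₀`; in this case `√C` is the radius of its isometric hemisphere. -/
theorem height_isometryEquiv (g : HypSpace ≃ᵢ HypSpace) :
    (∃ μ > 0, ∀ x, (g x).height = μ * x.height) ∨
    ∃ C > 0, ∃ w₀ : ℂ, ∀ x, (g x).height * (‖x.base - w₀‖ ^ 2 + x.height ^ 2) = C * x.height := by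
  obtain ⟨L, g', hL, hg', h⟩ := exists_linearEquiv_of_dist_eq (p := ⟨0, 1, one_pos⟩) one_pos
    (fun x _ y _ => g.dist_eq x y)
  refine height_formula_of_linearEquiv L hL g fun x => ?_
  rw [← hg' x, isometryEquiv_ext (g := g) (g' := g') (p := ⟨0, 1, one_pos⟩)]
  filter_upwards [Metric.ball_mem_nhds _ one_pos] with y hy using (h y hy).symm

end HypSpace

/-! ### Local isometries -/

lemma LocallyIsometricAt.exists_forall_le {P M : Type*} [MetricSpace M] {d : P → P → ℝ} {F : P → M}
    {p : P} (hd : d p p = 0) (h : LocallyIsometricAt d F p) :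
    ∃ ε₀ > 0, ∀ ε > 0, ε ≤ ε₀ →
      (∀ q q', d p q < ε → d p q' < ε → dist (F q) (F q') = d q q') ∧
        F '' {q | d p q < ε} = Metric.ball (F p) ε := by
  obtain ⟨ε₀, h0, h1, h2⟩ := h
  refine ⟨ε₀, h0, fun ε hε hle => ⟨fun q q' hq hq' => h1 q q' (hq.trans_le hle) (hq'.trans_le hle),
    ?_⟩⟩
  have hpp : d p p < ε₀ := by rwa [hd]
  apply Subset.antisymm
  · rintro _ ⟨q, hq, rfl⟩
    have hq : d p q < ε := hq
    rwa [Metric.mem_ball, dist_comm, h1 p q hpp (hq.trans_le hle)]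
  · intro y hy
    obtain ⟨q, hq, rfl⟩ := h2.symm.subset (Metric.ball_subset_ball hle hy)
    refine ⟨q, ?_, rfl⟩
    rwa [Metric.mem_ball, dist_comm, h1 p q hpp hq] at hy

namespace HypSpace

variable {M : Type*} [MetricSpace M]

lemma setOf_hdist_lt (p : HypSpace) (ε : ℝ) : {q | p.hdist q < ε} = Metric.ball p ε := by
  ext q
  rw [Metric.mem_ball, dist_comm]
  rfl

lemma locallyIsometricAt_of_ball {F : HypSpace → M} {p : HypSpace} {ε : ℝ} (hε : 0 < ε)
    (h : ∀ q ∈ Metric.ball p ε, ∀ q' ∈ Metric.ball p ε, dist (F q) (F q') = dist q q')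
    (h' : F '' Metric.ball p ε = Metric.ball (F p) ε) : LocallyIsometricAt hdist F p := by
  refine ⟨ε, hε, fun q q' hq hq' => h q ?_ q' ?_, ?_⟩
  · rwa [Metric.mem_ball, dist_comm]
  · rwa [Metric.mem_ball, dist_comm]
  · rw [setOf_hdist_lt, h']

lemma exists_forall_ball_of_locallyIsometricAt {F : HypSpace → M} {p : HypSpace}
    (h : LocallyIsometricAt hdist F p) : ∃ ε₀ > 0, ∀ ε > 0, ε ≤ ε₀ →
      (∀ q ∈ Metric.ball p ε, ∀ q' ∈ Metric.ball p ε, dist (F q) (F q') = dist q q') ∧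
      F '' Metric.ball p ε = Metric.ball (F p) ε := by
  obtain ⟨ε₀, h0, h1⟩ := h.exists_forall_le (hdist_self p)
  refine ⟨ε₀, h0, fun ε hε hle => ?_⟩
  obtain ⟨h2, h3⟩ := h1 ε hε hle
  refine ⟨fun q hq q' hq' => h2 q q' ?_ ?_, by rw [← h3, setOf_hdist_lt]⟩
  · rwa [Metric.mem_ball, dist_comm] at hq
  · rwa [Metric.mem_ball, dist_comm] at hq'

/-- A map which is isometric from a ball onto a ball is locally isometric at each point of the
ball. -/
lemma locallyIsometricAt_of_mem_ball {F : HypSpace → M} {p : HypSpace} {ε : ℝ} (hε : 0 < ε)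
    (h : ∀ q ∈ Metric.ball p ε, ∀ q' ∈ Metric.ball p ε, dist (F q) (F q') = dist q q')
    (h' : F '' Metric.ball p ε = Metric.ball (F p) ε) {y : HypSpace} (hy : y ∈ Metric.ball p ε) :
    LocallyIsometricAt hdist F y := by
  have hδ : 0 < ε - dist y p := sub_pos.2 hy
  have hsub : Metric.ball y (ε - dist y p) ⊆ Metric.ball p ε :=
    Metric.ball_subset_ball' (by linarith)
  refine locallyIsometricAt_of_ball hδ (fun q hq q' hq' => h q (hsub hq) q' (hsub hq')) ?_
  apply Subset.antisymm
  · rintro _ ⟨q, hq, rfl⟩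
    rwa [Metric.mem_ball, h q (hsub hq) y hy]
  · intro z hz
    have hz' : z ∈ Metric.ball (F p) ε := by
      rw [Metric.mem_ball] at hz ⊢
      have := dist_triangle z (F y) (F p)
      rw [h y hy p (Metric.mem_ball_self hε)] at this
      linarith
    obtain ⟨q, hq, rfl⟩ := h'.symm.subset hz'
    refine ⟨q, ?_, rfl⟩
    rwa [Metric.mem_ball, h q hq y hy] at hz

lemma continuousAt_of_locallyIsometricAt {F : HypSpace → M} {p : HypSpace}
    (h : LocallyIsometricAt hdist F p) : ContinuousAt F p := by
  obtain ⟨ε, hε, h1⟩ := exists_forall_ball_of_locallyIsometricAt h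
  rw [ContinuousAt, tendsto_iff_dist_tendsto_zero]
  have h2 : Tendsto (fun q => dist q p) (𝓝 p) (𝓝 0) := tendsto_iff_dist_tendsto_zero.1 tendsto_id
  refine h2.congr' ?_
  filter_upwards [Metric.ball_mem_nhds p hε] with q hq
  exact ((h1 ε hε le_rfl).1 q hq p (Metric.mem_ball_self hε)).symm

lemma locallyIsometricAt_congr {F F' : HypSpace → M} {p : HypSpace}
    (h : LocallyIsometricAt hdist F p) (hF : F =ᶠ[𝓝 p] F') : LocallyIsometricAt hdist F' p := by
  obtain ⟨ε, hε, h1⟩ := exists_forall_ball_of_locallyIsometricAt h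
  obtain ⟨δ, hδ, h2⟩ := Metric.eventually_nhds_iff_ball.1 hF
  obtain ⟨h3, h4⟩ := h1 (min ε δ) (lt_min hε hδ) (min_le_left _ _)
  have hs : Metric.ball p (min ε δ) ⊆ Metric.ball p δ := Metric.ball_subset_ball (min_le_right _ _)
  refine locallyIsometricAt_of_ball (lt_min hε hδ) (fun q hq q' hq' => ?_) ?_
  · rw [← h2 q (hs hq), ← h2 q' (hs hq'), h3 q hq q' hq']
  · rw [← h2 p (Metric.mem_ball_self hδ), ← h4]
    exact image_congr fun q hq => (h2 q (hs hq)).symm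

lemma locallyIsometricAt_comp {F : HypSpace → M} (g : HypSpace ≃ᵢ HypSpace) {p : HypSpace}
    (h : LocallyIsometricAt hdist F (g p)) : LocallyIsometricAt hdist (F ∘ g) p := by
  obtain ⟨ε, hε, h1⟩ := exists_forall_ball_of_locallyIsometricAt h
  obtain ⟨h3, h4⟩ := h1 ε hε le_rfl
  refine locallyIsometricAt_of_ball hε (fun q hq q' hq' => ?_) ?_
  · rw [← g.dist_eq q q']
    exact h3 _ (by rwa [Metric.mem_ball, g.dist_eq]) _ (by rwa [Metric.mem_ball, g.dist_eq])
  · rw [image_comp, g.image_ball, h4]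
    rfl

/-- Local isometries on a connected open set are determined by their germ at one point. -/
theorem eqOn_of_eventuallyEq {F F' : HypSpace → M} {s : Set HypSpace}
    (hs' : IsPreconnected s) (hF : ∀ p ∈ s, LocallyIsometricAt hdist F p)
    (hF' : ∀ p ∈ s, LocallyIsometricAt hdist F' p) {a : HypSpace} (ha : a ∈ s)
    (h : F =ᶠ[𝓝 a] F') : EqOn F F' s := by
  have key : s ⊆ {x | F =ᶠ[𝓝 x] F'} := by
    refine hs'.subset_of_closure_inter_subset ?_ ⟨a, ha, h⟩ ?_
    · exact isOpen_setOfPred_eventually_nhds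
    rintro x ⟨hx, hxs⟩
    have hfreq : ∃ᶠ y in 𝓝 x, F y = F' y :=
      (mem_closure_iff_frequently.1 hx).mono fun y (hy : F =ᶠ[𝓝 y] F') => hy.eq_of_nhds
    have hxx : F x = F' x := tendsto_nhds_unique_of_frequently_eq
      (continuousAt_of_locallyIsometricAt (hF x hxs))
      (continuousAt_of_locallyIsometricAt (hF' x hxs)) hfreq
    obtain ⟨ε₁, hε₁, h1⟩ := exists_forall_ball_of_locallyIsometricAt (hF x hxs)
    obtain ⟨ε₂, hε₂, h2⟩ := exists_forall_ball_of_locallyIsometricAt (hF' x hxs)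
    have hε := lt_min hε₁ hε₂
    obtain ⟨h3, h4⟩ := h1 _ hε (min_le_left _ _)
    obtain ⟨h5, h6⟩ := h2 _ hε (min_le_right _ _)
    obtain ⟨b, hb, hbx⟩ := Metric.mem_closure_iff.1 hx _ hε
    obtain ⟨O, hO, hOo, hbO⟩ := eventually_nhds_iff.1 hb
    filter_upwards [Metric.ball_mem_nhds x hε] with y hy
    have hFy : F y ∈ Metric.ball (F' x) (min ε₁ ε₂) := by
      rw [← hxx, ← h4]
      exact mem_image_of_mem F hy
    rw [← h6] at hFy
    obtain ⟨z, hz, hzy⟩ := hFy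
    have hyz : y = z := by
      refine eq_of_forall_dist_eq (hOo.inter Metric.isOpen_ball)
        ⟨hbO, show b ∈ Metric.ball x (min ε₁ ε₂) by rwa [Metric.mem_ball, dist_comm]⟩ ?_
      rintro c ⟨hcO, hc⟩
      rw [← h3 y hy c hc, ← h5 z hz c hc, hzy, hO c hcO]
    rw [← hzy, hyz]
  exact fun x hx => (key hx).self_of_nhds

/-- Two germs of local isometries with the same value differ by an isometry of hyperbolic space. -/
theorem exists_isometryEquiv_of_eq {F F' : HypSpace → M} {p q : HypSpace}
    (hp : LocallyIsometricAt hdist F p) (hq : LocallyIsometricAt hdist F' q) (h : F p = F' q) :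
    ∃ g : HypSpace ≃ᵢ HypSpace, g q = p ∧ F ∘ g =ᶠ[𝓝 q] F' := by
  obtain ⟨ε₁, hε₁, h1⟩ := exists_forall_ball_of_locallyIsometricAt hp
  obtain ⟨ε₂, hε₂, h2⟩ := exists_forall_ball_of_locallyIsometricAt hq
  have hε := lt_min hε₁ hε₂
  obtain ⟨h3, h4⟩ := h1 _ hε (min_le_left _ _)
  obtain ⟨h5, h6⟩ := h2 _ hε (min_le_right _ _)
  have hex : ∀ y : HypSpace, ∃ z, y ∈ Metric.ball q (min ε₁ ε₂) →
      z ∈ Metric.ball p (min ε₁ ε₂) ∧ F z = F' y := by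
    intro y
    by_cases hy : y ∈ Metric.ball q (min ε₁ ε₂)
    · have := mem_image_of_mem F' hy
      rw [h6, ← h, ← h4] at this
      obtain ⟨z, hz⟩ := this
      exact ⟨z, fun _ => hz⟩
    · exact ⟨p, fun hy' => absurd hy' hy⟩
  choose ψ hψ using hex
  obtain ⟨g, hg⟩ := exists_isometryEquiv_of_dist_eq (ψ := ψ) hε (fun x hx y hy => by
    rw [← h3 _ (hψ x hx).1 _ (hψ y hy).1, (hψ x hx).2, (hψ y hy).2, h5 x hx y hy])
  have hqq := Metric.mem_ball_self (x := q) hε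
  refine ⟨g, ?_, ?_⟩
  · rw [hg q hqq, ← dist_eq_zero, ← h3 _ (hψ q hqq).1 p (Metric.mem_ball_self hε), (hψ q hqq).2, h,
      dist_self]
  · filter_upwards [Metric.ball_mem_nhds q hε] with y hy
    rw [Function.comp_apply, hg y hy, (hψ y hy).2]

end HypSpace

/-- A curve in a metric space which is `K`-Lipschitz at each point is `K`-Lipschitz. -/
lemma dist_le_of_forall_eventually_dist_le {M : Type*} [PseudoMetricSpace M] {f : ℝ → M} {K a b : ℝ}
    (hab : a ≤ b) (h : ∀ t ∈ Icc a b, ∀ᶠ s in 𝓝 t, dist (f s) (f t) ≤ K * |s - t|) :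
    dist (f a) (f b) ≤ K * (b - a) := by
  have hc : ContinuousOn f (Icc a b) := by
    intro t ht
    apply ContinuousAt.continuousWithinAt
    rw [ContinuousAt, tendsto_iff_dist_tendsto_zero]
    have h1 : Tendsto (fun s => K * |s - t|) (𝓝 t) (𝓝 0) := by
      have : Continuous fun s => K * |s - t| := by fun_prop
      simpa using this.tendsto t
    exact squeeze_zero' (Eventually.of_forall fun _ => dist_nonneg) (h t ht) h1
  have hs : Icc a b ⊆ {t | dist (f a) (f t) ≤ K * (t - a)} := by
    refine IsClosed.Icc_subset_of_forall_mem_nhdsWithin ?_ (by simp) ?_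
    · have : ContinuousOn (fun t => dist (f a) (f t) - K * (t - a)) (Icc a b) := by fun_prop
      convert this.preimage_isClosed_of_isClosed isClosed_Icc (isClosed_Iic (a := 0)) using 1
      ext t
      simp [and_comm]
    · rintro t ⟨ht, ht'⟩
      filter_upwards [(h t (Ico_subset_Icc_self ht')).filter_mono nhdsWithin_le_nhds,
        self_mem_nhdsWithin] with s hs hst
      have hst : t < s := hst
      have ht : dist (f a) (f t) ≤ K * (t - a) := ht
      rw [abs_of_pos (sub_pos.2 hst)] at hs
      have := dist_triangle (f a) (f t) (f s)
      rw [dist_comm (f t)] at this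
      show dist (f a) (f s) ≤ K * (s - a)
      linarith
  exact hs (right_mem_Icc.2 hab)

namespace HypSpace

variable {M : Type*} [MetricSpace M]

lemma dist_comp_le {F : HypSpace → M} {γ : ℝ → HypSpace} {K a b : ℝ} (hab : a ≤ b)
    (hγ : ∀ s t, dist (γ s) (γ t) ≤ K * |s - t|)
    (hF : ∀ t ∈ Icc a b, LocallyIsometricAt hdist F (γ t)) :
    dist (F (γ a)) (F (γ b)) ≤ K * (b - a) := by
  refine dist_le_of_forall_eventually_dist_le (f := F ∘ γ) hab fun t ht => ?_
  obtain ⟨ε, hε, h1⟩ := exists_forall_ball_of_locallyIsometricAt (hF t ht)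
  have hc : ContinuousAt γ t := by
    rw [ContinuousAt, tendsto_iff_dist_tendsto_zero]
    have h1 : Tendsto (fun s => K * |s - t|) (𝓝 t) (𝓝 0) := by
      have : Continuous fun s => K * |s - t| := by fun_prop
      simpa using this.tendsto t
    exact squeeze_zero (fun _ => dist_nonneg) (fun s => hγ s t) h1
  filter_upwards [hc.eventually_mem (Metric.ball_mem_nhds _ hε)] with s hs
  rw [Function.comp_apply, Function.comp_apply,
    (h1 ε hε le_rfl).1 _ hs _ (Metric.mem_ball_self hε)]
  exact hγ s t

/-- The isometry `translate v`. -/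
noncomputable def translateEquiv (v : ℂ) : HypSpace ≃ᵢ HypSpace :=
  IsometryEquiv.mk' (translate v) (translate (-v)) (fun p => by simp [translate])
    (Isometry.of_dist_eq fun p q => by simp [translate, dist_def, hdist])

@[simp] lemma translateEquiv_apply (v : ℂ) (p : HypSpace) :
    translateEquiv v p = p.translate v := rfl

@[simp] lemma translateEquiv_symm_apply (v : ℂ) (p : HypSpace) :
    (translateEquiv v).symm p = p.translate (-v) := rfl

@[simp] lemma height_translate (v : ℂ) (p : HypSpace) : (p.translate v).height = p.height := rfl

@[simp] lemma base_translate (v : ℂ) (p : HypSpace) : (p.translate v).base = p.base + v := rfl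

lemma dist_mk_mk_le (w w' : ℂ) (s : ℝ) (hs : 0 < s) :
    dist (⟨w, s, hs⟩ : HypSpace) ⟨w', s, hs⟩ ≤ ‖w - w'‖ / s := by
  have h0 : 0 ≤ ‖w - w'‖ / s := by positivity
  rw [← abs_of_nonneg h0, ← abs_of_nonneg (dist_nonneg : 0 ≤ dist (⟨w, s, hs⟩ : HypSpace) _),
    ← Real.cosh_le_cosh, dist_def, cosh_hdist]
  have h1 : ‖w - w'‖ / s / 2 ≤ Real.sinh (‖w - w'‖ / s / 2) :=
    Real.self_le_sinh_iff.2 (by positivity)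
  have h2 : Real.cosh (‖w - w'‖ / s) = 1 + 2 * Real.sinh (‖w - w'‖ / s / 2) ^ 2 := by
    rw [← mul_div_cancel₀ (‖w - w'‖ / s) two_ne_zero, mul_div_assoc, Real.cosh_two_mul,
      Real.cosh_sq]
    ring_nf
  have h3 : (‖w - w'‖ / s / 2) ^ 2 ≤ Real.sinh (‖w - w'‖ / s / 2) ^ 2 :=
    pow_le_pow_left₀ (by positivity) h1 2
  have h4 : 1 + (‖w - w'‖ ^ 2 + (s - s) ^ 2) / (2 * s * s) = 1 + 2 * (‖w - w'‖ / s / 2) ^ 2 := by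
    field_simp
    ring
  rw [h2]
  exact h4.trans_le (by linarith)

lemma dist_vertical (w : ℂ) (s t : ℝ) : dist (⟨w, Real.exp s, Real.exp_pos s⟩ : HypSpace)
    ⟨w, Real.exp t, Real.exp_pos t⟩ = |s - t| := by
  apply dist_eq_of_cosh_eq (abs_nonneg _)
  rw [Real.cosh_abs, Real.cosh_eq, neg_sub, Real.exp_sub, Real.exp_sub]
  simp
  field_simp

/-- A local isometry does not increase the length of a horizontal segment followed by a vertical
one. -/
lemma dist_le_of_locallyIsometricAt {F : HypSpace → M} {k : ℝ}
    (hF : ∀ p, k < p.height → LocallyIsometricAt hdist F p) {p q : HypSpace} (hp : k < p.height)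
    (hpq : p.height ≤ q.height) :
    dist (F p) (F q) ≤ ‖p.base - q.base‖ / p.height + (Real.log q.height - Real.log p.height) := by
  have h1 : dist (F p) (F ⟨q.base, p.height, p.height_pos⟩) ≤ ‖p.base - q.base‖ / p.height := by
    have := dist_comp_le (F := F) (K := ‖p.base - q.base‖ / p.height)
      (γ := fun t => ⟨p.base + t • (q.base - p.base), p.height, p.height_pos⟩) zero_le_one
      (fun s t => (dist_mk_mk_le _ _ _ _).trans (le_of_eq (by
        rw [add_sub_add_left_eq_sub, ← sub_smul, norm_smul, norm_sub_rev p.base, Real.norm_eq_abs]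
        ring))) (fun t _ => hF _ hp)
    simpa using this
  have h2 : dist (F ⟨q.base, p.height, p.height_pos⟩) (F q) ≤
      Real.log q.height - Real.log p.height := by
    have := dist_comp_le (F := F) (K := 1)
      (γ := fun t => ⟨q.base, Real.exp t, Real.exp_pos t⟩)
      (Real.log_le_log p.height_pos hpq)
      (fun s t => by rw [dist_vertical, one_mul])
      (fun t ht => hF _ (hp.trans_le ((Real.log_le_iff_le_exp p.height_pos).1 ht.1)))
    simpa [Real.exp_log p.height_pos, Real.exp_log q.height_pos] using this
  exact (dist_triangle _ _ _).trans (add_le_add h1 h2)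

end HypSpace

/-! ### Geodesics in a tube about the singular locus -/

namespace ConePoint

lemma one_le_cosh_arg (p q : ConePoint) (α : ℝ) : Real.cosh (p.radius - q.radius) ≤
    Real.cosh p.radius * Real.cosh q.radius * Real.cosh (p.axial - q.axial) -
      Real.sinh p.radius * Real.sinh q.radius *
        Real.cos (min Real.pi ‖((p.angle - q.angle : ℝ) : AddCircle α)‖) := by
  rw [Real.cosh_sub]
  have h1 := Real.one_le_cosh (p.axial - q.axial)
  have h2 := Real.cos_le_one (min Real.pi ‖((p.angle - q.angle : ℝ) : AddCircle α)‖)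
  have h3 := mul_pos (Real.cosh_pos p.radius) (Real.cosh_pos q.radius)
  have h4 := mul_nonneg (Real.sinh_nonneg_iff.2 p.radius_nonneg)
    (Real.sinh_nonneg_iff.2 q.radius_nonneg)
  nlinarith

lemma cosh_cdist (α : ℝ) (p q : ConePoint) : Real.cosh (cdist α p q) =
    Real.cosh p.radius * Real.cosh q.radius * Real.cosh (p.axial - q.axial) -
      Real.sinh p.radius * Real.sinh q.radius *
        Real.cos (min Real.pi ‖((p.angle - q.angle : ℝ) : AddCircle α)‖) :=
  Real.cosh_arcosh ((Real.one_le_cosh _).trans (one_le_cosh_arg p q α))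

lemma cdist_nonneg (α : ℝ) (p q : ConePoint) : 0 ≤ cdist α p q :=
  Real.arcosh_nonneg ((Real.one_le_cosh _).trans (one_le_cosh_arg p q α))

lemma cdist_self (α : ℝ) (p : ConePoint) : cdist α p p = 0 := by
  have h := cosh_cdist α p p
  rw [sub_self, sub_self, Real.cosh_zero, AddCircle.coe_zero, norm_zero,
    min_eq_right Real.pi_pos.le, Real.cos_zero, mul_one, mul_one] at h
  have h2 := Real.cosh_sq p.radius
  apply Real.cosh_injOn (cdist_nonneg _ _ _) self_mem_Ici
  rw [h, Real.cosh_zero]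
  linarith

lemma abs_radius_sub_le (α : ℝ) (p q : ConePoint) : |p.radius - q.radius| ≤ cdist α p q := by
  rw [← abs_of_nonneg (cdist_nonneg α p q), ← Real.cosh_le_cosh, cosh_cdist]
  exact one_le_cosh_arg p q α

/-- The distance to the singular axis is strictly convex along geodesics off the axis: if `p` is
the midpoint of a short geodesic segment from `p₁` to `p₂`, then `p₁` or `p₂` is farther from the
axis. In the hyperboloid model, with `P = (cosh ρ, 0, sinh ρ, 0)`, the vector `Y = P₁ + P₂ - 2
(cosh ε) P` is orthogonal to the timelike vector `P`, and it is not spacelike, so it vanishes. -/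
lemma radius_lt_of_midpoint {α ε : ℝ} {p p₁ p₂ : ConePoint} (hε : 0 < ε) (hεp : ε < p.radius)
    (h₁ : cdist α p p₁ = ε) (h₂ : cdist α p p₂ = ε) (h₁₂ : 2 * ε ≤ cdist α p₁ p₂)
    (hr₁ : p₁.radius ≤ p.radius) (hr₂ : p₂.radius ≤ p.radius) : False := by
  have hp : 0 < p.radius := hε.trans hεp
  -- the short segment does not wind around the axis
  have angle_lt : ∀ q : ConePoint, cdist α p q = ε →
      ‖((p.angle - q.angle : ℝ) : AddCircle α)‖ < Real.pi / 2 := by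
    intro q hq
    by_contra! hge
    have hcos : Real.cos (min Real.pi ‖((p.angle - q.angle : ℝ) : AddCircle α)‖) ≤ 0 :=
      Real.cos_nonpos_of_pi_div_two_le_of_le
        (le_min (by linarith [Real.pi_pos]) hge)
        ((min_le_left _ _).trans (by linarith [Real.pi_pos]))
    have h := cosh_cdist α p q
    rw [hq] at h
    have h3 : Real.cosh ε < Real.cosh p.radius := by
      rwa [Real.cosh_lt_cosh, abs_of_pos hε, abs_of_pos hp]
    have h4 := mul_nonneg (Real.sinh_nonneg_iff.2 hp.le) (Real.sinh_nonneg_iff.2 q.radius_nonneg)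
    have h5 := Real.one_le_cosh q.radius
    have h6 := Real.one_le_cosh (p.axial - q.axial)
    have h7 : Real.cosh p.radius * 1 * 1 ≤
        Real.cosh p.radius * Real.cosh q.radius * Real.cosh (p.axial - q.axial) := by
      have := Real.cosh_pos p.radius
      gcongr
    nlinarith
  have e₁ := cosh_cdist α p p₁
  have e₂ := cosh_cdist α p p₂
  have e₁₂ := cosh_cdist α p₁ p₂
  have a_lt := angle_lt p₁ h₁
  have b_lt := angle_lt p₂ h₂
  have hab : ‖((p₁.angle - p₂.angle : ℝ) : AddCircle α)‖ ≤
      ‖((p.angle - p₁.angle : ℝ) : AddCircle α)‖ + ‖((p.angle - p₂.angle : ℝ) : AddCircle α)‖ := by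
    have : ((p₁.angle - p₂.angle : ℝ) : AddCircle α) =
        ((p.angle - p₂.angle : ℝ) : AddCircle α) - ((p.angle - p₁.angle : ℝ) : AddCircle α) := by
      rw [← AddCircle.coe_sub]
      congr 1
      ring
    rw [this, add_comm]
    exact norm_sub_le _ _
  have ha0 := norm_nonneg ((p.angle - p₁.angle : ℝ) : AddCircle α)
  have hb0 := norm_nonneg ((p.angle - p₂.angle : ℝ) : AddCircle α)
  have hc0 := norm_nonneg ((p₁.angle - p₂.angle : ℝ) : AddCircle α)
  rw [min_eq_right (by linarith)] at e₁ e₂ e₁₂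
  rw [h₁] at e₁
  rw [h₂] at e₂
  have hcab := Real.cos_le_cos_of_nonneg_of_le_pi hc0 (by linarith) hab
  generalize ‖((p.angle - p₁.angle : ℝ) : AddCircle α)‖ = a at *
  generalize ‖((p.angle - p₂.angle : ℝ) : AddCircle α)‖ = b at *
  generalize ‖((p₁.angle - p₂.angle : ℝ) : AddCircle α)‖ = c at *
  have h₁₂' : 2 * Real.cosh ε ^ 2 - 1 ≤ Real.cosh (cdist α p₁ p₂) := by
    have h : Real.cosh (2 * ε) ≤ Real.cosh (cdist α p₁ p₂) := by
      rwa [Real.cosh_le_cosh, abs_of_pos (by linarith), abs_of_nonneg (cdist_nonneg _ _ _)]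
    rw [Real.cosh_two_mul, Real.sinh_sq] at h
    linarith
  rw [e₁₂, show p₁.axial - p₂.axial = (p.axial - p₂.axial) - (p.axial - p₁.axial) by ring,
    Real.cosh_sub] at h₁₂'
  rw [Real.cos_add] at hcab
  have s1 := Real.sinh_nonneg_iff.2 p₁.radius_nonneg
  have s2 := Real.sinh_nonneg_iff.2 p₂.radius_nonneg
  have s := Real.sinh_pos_iff.2 hp
  have t1 := Real.sinh_le_sinh.2 hr₁
  have t2 := Real.sinh_le_sinh.2 hr₂
  have hcosh : 1 < Real.cosh ε := Real.one_lt_cosh.2 hε.ne'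
  have q := Real.cosh_sq p.radius
  have q1 := Real.cosh_sq p₁.radius
  have q2 := Real.cosh_sq p₂.radius
  have z1 := Real.cosh_sq (p.axial - p₁.axial)
  have z2 := Real.cosh_sq (p.axial - p₂.axial)
  have ca := Real.sin_sq_add_cos_sq a
  have cb := Real.sin_sq_add_cos_sq b
  have ca1 := Real.cos_le_one a
  have cb1 := Real.cos_le_one b
  generalize Real.cosh (p.axial - p₁.axial) = C1 at *
  generalize Real.cosh (p.axial - p₂.axial) = C2 at *
  generalize Real.sinh (p.axial - p₁.axial) = S1 at *
  generalize Real.sinh (p.axial - p₂.axial) = S2 at *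
  generalize Real.cosh p.radius = ch at *
  generalize Real.cosh p₁.radius = ch1 at *
  generalize Real.cosh p₂.radius = ch2 at *
  generalize Real.sinh p.radius = sh at *
  generalize Real.sinh p₁.radius = sh1 at *
  generalize Real.sinh p₂.radius = sh2 at *
  generalize Real.cos a = cosa at *
  generalize Real.cos b = cosb at *
  generalize Real.sin a = sina at *
  generalize Real.sin b = sinb at *
  generalize Real.cosh ε = K at *
  have hG : 2 * K ^ 2 - 1 ≤ ch1 * ch2 * (C2 * C1 - S2 * S1) -
      sh1 * sh2 * (cosa * cosb - sina * sinb) := by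
    linarith [mul_le_mul_of_nonneg_left hcab (mul_nonneg s1 s2)]
  obtain ⟨Y0, hY0⟩ : ∃ Y0, Y0 = ch1 * C1 + ch2 * C2 - 2 * K * ch := ⟨_, rfl⟩
  obtain ⟨Y2, hY2⟩ : ∃ Y2, Y2 = sh1 * cosa + sh2 * cosb - 2 * K * sh := ⟨_, rfl⟩
  have orth : Y0 * ch = Y2 * sh := by
    rw [hY0, hY2]
    linear_combination -e₁ - e₂ - 2 * K * q
  have timelike : (ch1 * S1 + ch2 * S2) ^ 2 + (sh1 * sina - sh2 * sinb) ^ 2 ≤ Y0 ^ 2 - Y2 ^ 2 := by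
    have : Y0 ^ 2 - Y2 ^ 2 - (ch1 * S1 + ch2 * S2) ^ 2 - (sh1 * sina - sh2 * sinb) ^ 2 =
        2 + 2 * (ch1 * ch2 * (C2 * C1 - S2 * S1) - sh1 * sh2 * (cosa * cosb - sina * sinb))
          - 4 * K ^ 2 := by
      rw [hY0, hY2]
      linear_combination ch1 ^ 2 * z1 + ch2 ^ 2 * z2 - sh1 ^ 2 * ca - sh2 ^ 2 * cb + q1 + q2 +
        4 * K ^ 2 * q + 4 * K * e₁ + 4 * K * e₂
    linarith
  have hneg : Y2 < 0 := by
    rw [hY2]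
    linarith [mul_le_mul_of_nonneg_left ca1 s1, mul_le_mul_of_nonneg_left cb1 s2,
      mul_pos s (sub_pos.2 hcosh)]
  have hle : Y2 ^ 2 ≤ Y0 ^ 2 := by
    linarith [sq_nonneg (ch1 * S1 + ch2 * S2), sq_nonneg (sh1 * sina - sh2 * sinb)]
  have h3 : Y0 ^ 2 * ch ^ 2 = Y2 ^ 2 * sh ^ 2 := by
    rw [← mul_pow, orth, mul_pow]
  have h4 : 0 < Y2 ^ 2 := sq_pos_iff.2 hneg.ne
  have h5 : Y2 ^ 2 * ch ^ 2 = Y2 ^ 2 * sh ^ 2 + Y2 ^ 2 := by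
    rw [q]
    ring
  linarith [mul_le_mul_of_nonneg_right hle (sq_nonneg ch)]

end ConePoint

/-- A geodesic which starts and ends on the singular locus and meets it nowhere else leaves every
embedded tube. -/
theorem HasEmbeddedTube.not_return {M : Type*} [MetricSpace M] {S : Set M} {r T : ℝ} {c : ℝ → M}
    (h : HasEmbeddedTube S r) (hT : 0 < T) (hc : ContinuousOn c (Icc (-T) T)) (hl : c (-T) ∈ S)
    (hr : c T ∈ S) (hmem : ∀ t ∈ Icc (-T) T, c t ∈ Metric.thickening r S)
    (hnotMem : ∀ t ∈ Ioo (-T) T, c t ∉ S)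
    (hgeod : ∀ t ∈ Ioo (-T) T, ∀ᶠ s in 𝓝 (t, t), dist (c s.1) (c s.2) = |s.1 - s.2|) : False := by
  obtain ⟨n, α, ℓ, tw, F, hpos, hF, hiff, hthick, hS⟩ := h
  have hr0 : 0 < r := by
    by_contra! hneg
    have := hmem T ⟨by linarith, le_rfl⟩
    rw [Metric.thickening_of_nonpos hneg] at this
    exact this
  have hex : ∀ y : M, ∃ ρ : ℝ, ∀ i p, p.radius < r → F i p = y → p.radius = ρ := by
    intro y
    by_cases hy : ∃ i p, p.radius < r ∧ F i p = y
    · obtain ⟨i, p, hp, rfl⟩ := hy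
      exact ⟨p.radius, fun j q hq hjq => ((hiff j i q p hq hp).1 hjq).2.1⟩
    · exact ⟨0, fun i p hp hip => absurd ⟨i, p, hp, hip⟩ hy⟩
  choose ρ hρ using hex
  have hlift : ∀ y ∈ Metric.thickening r S, ∃ i p, p.radius < r ∧ F i p = y := by
    intro y hy
    rw [← hthick] at hy
    obtain ⟨i, p, hp, rfl⟩ := mem_iUnion.1 hy
    exact ⟨i, p, hp, rfl⟩
  have hρS : ∀ y ∈ Metric.thickening r S, ρ y = 0 ↔ y ∈ S := by
    intro y hy
    rw [← hS]
    constructor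
    · intro h0
      obtain ⟨i, p, hp, rfl⟩ := hlift y hy
      rw [← hρ _ i p hp rfl] at h0
      exact mem_iUnion.2 ⟨i, p, h0, rfl⟩
    · intro h0
      obtain ⟨i, p, hp, rfl⟩ := mem_iUnion.1 h0
      have hp : p.radius = 0 := hp
      rw [← hρ _ i p (by rwa [hp]) rfl, hp]
  have hρ0 : ∀ y ∈ Metric.thickening r S, 0 ≤ ρ y := by
    intro y hy
    obtain ⟨i, p, hp, rfl⟩ := hlift y hy
    rw [← hρ _ i p hp rfl]
    exact p.radius_nonneg
  have hρc : ∀ y ∈ Metric.thickening r S, ContinuousAt ρ y := by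
    intro y hy
    obtain ⟨i, p, hp, rfl⟩ := hlift y hy
    obtain ⟨ε₀, hε₀, h1⟩ := (hF i p hp).exists_forall_le (ConePoint.cdist_self _ p)
    obtain ⟨h2, h3⟩ := h1 (min ε₀ (r - p.radius)) (lt_min hε₀ (sub_pos.2 hp)) (min_le_left _ _)
    rw [ContinuousAt, tendsto_iff_dist_tendsto_zero]
    refine squeeze_zero' (g := fun y => dist (F i p) y) (Eventually.of_forall fun _ => dist_nonneg)
      ?_ ?_
    · filter_upwards [Metric.ball_mem_nhds (F i p) (lt_min hε₀ (sub_pos.2 hp))] with y hy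
      obtain ⟨q, hq, rfl⟩ := h3.symm.subset hy
      have hq : ConePoint.cdist (α i) p q < min ε₀ (r - p.radius) := hq
      have h4 := ConePoint.abs_radius_sub_le (α i) p q
      have hqr : q.radius < r := by
        have := hq.trans_le (min_le_right _ _)
        have := neg_abs_le (p.radius - q.radius)
        linarith
      rw [← hρ _ i p hp rfl, ← hρ _ i q hqr rfl, Real.dist_eq, abs_sub_comm, h2 p q _ hq]
      · exact h4
      · rw [ConePoint.cdist_self]
        exact lt_min hε₀ (sub_pos.2 hp)
    · have : Continuous fun y => dist (F i p) y := by fun_prop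
      simpa using this.tendsto (F i p)
  have hfc : ContinuousOn (ρ ∘ c) (Icc (-T) T) := fun t ht =>
    (hρc _ (hmem t ht)).comp_continuousWithinAt (hc t ht)
  obtain ⟨t, ht, hmax⟩ := isCompact_Icc.exists_isMaxOn
    (nonempty_Icc.2 (by linarith : -T ≤ T)) hfc
  have h0m : (0 : ℝ) ∈ Ioo (-T) T := ⟨by linarith, hT⟩
  have hpos0 : 0 < ρ (c 0) := lt_of_le_of_ne (hρ0 _ (hmem 0 (Ioo_subset_Icc_self h0m)))
    fun h => hnotMem 0 h0m ((hρS _ (hmem 0 (Ioo_subset_Icc_self h0m))).1 h.symm)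
  have hposm : 0 < ρ (c t) := hpos0.trans_le (hmax (Ioo_subset_Icc_self h0m))
  have htI : t ∈ Ioo (-T) T := by
    refine ⟨lt_of_le_of_ne ht.1 ?_, lt_of_le_of_ne ht.2 ?_⟩
    · rintro rfl
      rw [(hρS _ (hmem _ ht)).2 hl] at hposm
      exact hposm.ne rfl
    · rintro rfl
      rw [(hρS _ (hmem _ ht)).2 hr] at hposm
      exact hposm.ne rfl
  obtain ⟨i, p, hp, hpt⟩ := hlift _ (hmem t ht)
  rw [← hρ _ i p hp hpt] at hposm
  obtain ⟨ε₀, hε₀, h1⟩ := (hF i p hp).exists_forall_le (ConePoint.cdist_self _ p)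
  obtain ⟨δ, hδ, h2⟩ := Metric.eventually_nhds_iff.1 (hgeod t htI)
  -- a segment about the farthest point `c t` which is so short that it lifts to the cone model
  obtain ⟨ε, hε, hεlt⟩ : ∃ ε > 0, ε < min (min ε₀ (r - p.radius)) (min (min δ p.radius)
      (min (t + T) (T - t))) := exists_between (lt_min (lt_min hε₀ (sub_pos.2 hp))
        (lt_min (lt_min hδ hposm) (lt_min (by linarith [htI.1]) (by linarith [htI.2]))))
  simp only [lt_min_iff] at hεlt
  obtain ⟨⟨l1, l2⟩, ⟨l3, l4⟩, l5, l6⟩ := hεlt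
  obtain ⟨h3, h4⟩ := h1 ε₀ hε₀ le_rfl
  have geo : ∀ s s', |s - t| ≤ ε → |s' - t| ≤ ε → dist (c s) (c s') = |s - s'| := by
    intro s s' hs hs'
    refine h2 (y := (s, s')) ?_
    rw [Prod.dist_eq, Real.dist_eq, Real.dist_eq]
    exact max_lt (hs.trans_lt l3) (hs'.trans_lt l3)
  have abs_m : |t - ε - t| = ε := by rw [sub_sub_cancel_left, abs_neg, abs_of_pos hε]
  have abs_p : |t + ε - t| = ε := by rw [add_sub_cancel_left, abs_of_pos hε]
  have abs_0 : |t - t| ≤ ε := by simpa using hε.le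
  have lift : ∀ s, |s - t| = ε → ∃ q : ConePoint, q.radius < r ∧ F i q = c s ∧
      ConePoint.cdist (α i) p q = ε := by
    intro s hs
    have : c s ∈ Metric.ball (F i p) ε₀ := by
      rw [Metric.mem_ball, hpt, geo s t hs.le abs_0, hs]
      exact l1
    obtain ⟨q, hq, hqs⟩ := h4.symm.subset this
    have hq : ConePoint.cdist (α i) p q < ε₀ := hq
    have hd : ConePoint.cdist (α i) p q = ε := by
      rw [← h3 p q (by rwa [ConePoint.cdist_self]) hq, hpt, hqs, dist_comm, geo s t hs.le abs_0, hs]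
    refine ⟨q, ?_, hqs, hd⟩
    have := ConePoint.abs_radius_sub_le (α i) p q
    have := neg_abs_le (p.radius - q.radius)
    linarith
  obtain ⟨p₁, hp₁, hc₁, hd₁⟩ := lift _ abs_m
  obtain ⟨p₂, hp₂, hc₂, hd₂⟩ := lift _ abs_p
  have rad : ∀ s, s ∈ Icc (-T) T → ∀ q : ConePoint, q.radius < r → F i q = c s →
      q.radius ≤ p.radius := by
    intro s hs q hq hqs
    rw [hρ _ i q hq hqs, hρ _ i p hp hpt]
    exact hmax hs
  refine ConePoint.radius_lt_of_midpoint hε l4 hd₁ hd₂ ?_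
    (rad _ ⟨by linarith, by linarith⟩ _ hp₁ hc₁) (rad _ ⟨by linarith, by linarith⟩ _ hp₂ hc₂)
  rw [← h3 p₁ p₂ (by rwa [hd₁]) (by rwa [hd₂]), hc₁, hc₂, geo _ _ abs_m.le abs_p.le,
    show t - ε - (t + ε) = -(2 * ε) by ring, abs_neg, abs_of_pos (by linarith)]

/-! ### Extending the parametrization of a cusp below the horoball -/

namespace HoroballNbhd

open HypSpace

variable {M : Type*} [MetricSpace M] {S : Set M}

/-- `F` extends the parametrization of the horoball neighborhood `U` to a (not necessarily
injective) local isometry from the horoball of level `k` to the complement of `S`. -/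
structure IsExtension (U : HoroballNbhd S) (k : ℝ) (F : HypSpace → M) : Prop where
  locallyIsometric : ∀ p, k < p.height → LocallyIsometricAt hdist F p
  notMem : ∀ p, k < p.height → F p ∉ S
  eq_param : ∀ p, U.level < p.height → F p = U.param p

variable {U : HoroballNbhd S} {k k' : ℝ} {F F' : HypSpace → M}

lemma isExtension_param (U : HoroballNbhd S) : U.IsExtension U.level U.param :=
  ⟨U.locallyIsometric, U.param_notMem, fun _ _ => rfl⟩

lemma IsExtension.mono (h : U.IsExtension k F) (hk : k ≤ k') : U.IsExtension k' F :=
  ⟨fun p hp => h.1 p (hk.trans_lt hp), fun p hp => h.2 p (hk.trans_lt hp), h.3⟩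

lemma IsExtension.eqOn (h : U.IsExtension k F) (h' : U.IsExtension k F') :
    EqOn F F' {p | k < p.height} := by
  have hpos : 0 < max k U.level + 1 := by linarith [U.level_pos, le_max_right k U.level]
  refine eqOn_of_eventuallyEq (isPreconnected_setOf_lt_height k) h.1 h'.1
    (a := ⟨0, max k U.level + 1, hpos⟩) ?_ ?_
  · show k < max k U.level + 1
    linarith [le_max_left k U.level]
  · filter_upwards [(isOpen_setOf_lt_height U.level).mem_nhds
      (show U.level < max k U.level + 1 by linarith [le_max_right k U.level])] with p hp
    rw [h.3 p hp, h'.3 p hp]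

lemma IsExtension.translate (h : U.IsExtension k F) {v : ℂ} (hv : v ∈ U.lattice) {p : HypSpace}
    (hp : k < p.height) : F (p.translate v) = F p := by
  have h' : U.IsExtension k (F ∘ translateEquiv v) := by
    refine ⟨fun p hp => locallyIsometricAt_comp _ (h.1 _ hp), fun p hp => h.2 _ hp, fun p hp => ?_⟩
    rw [Function.comp_apply, translateEquiv_apply, h.3 (p.translate v) hp]
    exact ((U.param_eq_iff p (p.translate v) hp hp).2 ⟨v, hv, rfl⟩).symm
  exact (h.eqOn h' hp).symm

/-- By completeness, an extension to an open horoball has limits at the points of the boundary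
horosphere. -/
lemma IsExtension.exists_limit [CompleteSpace M] (h : U.IsExtension k F) (hk : 0 < k) (w : ℂ) :
    ∃ x, ∀ q, k < q.height →
      dist (F q) x ≤ ‖q.base - w‖ / k + (Real.log q.height - Real.log k) := by
  let p : ℕ → HypSpace := fun n => ⟨w, k * Real.exp (1 / (n + 1)), by positivity⟩
  have hlog : ∀ n, Real.log (p n).height = Real.log k + 1 / (n + 1) := fun n => by
    rw [Real.log_mul hk.ne' (Real.exp_pos _).ne', Real.log_exp]
  have hlt : ∀ n, k < (p n).height := fun n => by
    rw [← Real.log_lt_log_iff hk (p n).height_pos, hlog]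
    have : (0 : ℝ) < 1 / (n + 1) := by positivity
    linarith
  have hlim : Tendsto (fun n : ℕ => (1 : ℝ) / (n + 1)) atTop (𝓝 0) :=
    tendsto_one_div_add_atTop_nhds_zero_nat
  have hle : ∀ n m : ℕ, n ≤ m → dist (F (p m)) (F (p n)) ≤ 1 / (n + 1) := by
    intro n m hnm
    have h1 : (1 : ℝ) / (m + 1) ≤ 1 / (n + 1) := by gcongr
    have h2 : (0 : ℝ) < 1 / (m + 1) := by positivity
    have := dist_le_of_locallyIsometricAt h.1 (hlt m) (q := p n) (by
      rw [← Real.log_le_log_iff (p m).height_pos (p n).height_pos, hlog, hlog]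
      linarith)
    rw [hlog, hlog, show (p m).base = (p n).base from rfl, sub_self, norm_zero, zero_div] at this
    linarith
  have hc : CauchySeq fun n => F (p n) := by
    refine cauchySeq_of_le_tendsto_0 (fun n : ℕ => (1 : ℝ) / (n + 1) + 1 / (n + 1)) ?_
      (by simpa using hlim.add hlim)
    intro n m N hn hm
    refine (dist_triangle _ (F (p N)) _).trans (add_le_add (hle N n hn) ?_)
    rw [dist_comm]
    exact hle N m hm
  obtain ⟨x, hx⟩ := cauchySeq_tendsto_of_complete hc
  refine ⟨x, fun q hq => ?_⟩
  refine le_of_tendsto (tendsto_const_nhds.dist hx) ?_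
  have hqk : 0 < Real.log q.height - Real.log k := sub_pos.2 (Real.log_lt_log hk hq)
  filter_upwards [hlim.eventually (gt_mem_nhds hqk)] with n hn
  have h1 := dist_le_of_locallyIsometricAt h.1 (hlt n) (q := q) (by
    rw [← Real.log_le_log_iff (p n).height_pos q.height_pos, hlog]
    linarith)
  rw [dist_comm, norm_sub_rev, hlog] at h1
  refine h1.trans (add_le_add ?_ ?_)
  · exact div_le_div_of_nonneg_left (norm_nonneg _) hk (hlt n).le
  · have : (0 : ℝ) < 1 / (n + 1) := by positivity
    linarith

/-- An extension to an open horoball extends further near a boundary point whose image is a regular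
point. -/
lemma IsExtension.exists_local_extension (hM : IsHyperbolicConeManifold M S)
    (h : U.IsExtension k F) (hk : 0 < k) {w : ℂ} {x : M}
    (hx : ∀ q, k < q.height → dist (F q) x ≤ ‖q.base - w‖ / k + (Real.log q.height - Real.log k))
    (hxS : x ∉ S) : ∃ δ > 0, ∃ G : HypSpace → M, ∀ y ∈ Metric.ball ⟨w, k, hk⟩ δ,
      LocallyIsometricAt hdist G y ∧ G y ∉ S ∧ (k < y.height → G y = F y) := by
  obtain ⟨Φ, p, rfl, hΦ⟩ := hM.regular x hxS
  obtain ⟨ε₁, hε₁, h1⟩ := exists_forall_ball_of_locallyIsometricAt hΦ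
  obtain ⟨ε₂, hε₂, h2⟩ := Metric.isOpen_iff.1 hM.isCompact_singular.isClosed.isOpen_compl _ hxS
  obtain ⟨τ, hτ, hτlt⟩ : ∃ τ > 0, 4 * τ < min ε₁ ε₂ :=
    ⟨min ε₁ ε₂ / 5, by positivity, by linarith [lt_min hε₁ hε₂]⟩
  obtain ⟨h3, h4⟩ := h1 (4 * τ) (by positivity) (hτlt.le.trans (min_le_left _ _))
  let y₀ : HypSpace := ⟨w, k * Real.exp τ, by positivity⟩
  have hlog : Real.log y₀.height = Real.log k + τ := by
    rw [Real.log_mul hk.ne' (Real.exp_pos _).ne', Real.log_exp]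
  have hy₀ : k < y₀.height := by
    rw [← Real.log_lt_log_iff hk y₀.height_pos, hlog]
    linarith
  have hy₀d : dist y₀ ⟨w, k, hk⟩ = τ := by
    apply dist_eq_of_cosh_eq hτ.le
    simp only [y₀, sub_self, norm_zero]
    rw [Real.cosh_eq, Real.exp_neg]
    field_simp
    ring
  have hFy₀ : dist (F y₀) (Φ p) ≤ τ := by
    have := hx y₀ hy₀
    rw [hlog, show y₀.base = w from rfl, sub_self, norm_zero, zero_div] at this
    linarith
  have hmem : F y₀ ∈ Metric.ball (Φ p) (4 * τ) := by
    rw [Metric.mem_ball]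
    linarith
  rw [← h4] at hmem
  obtain ⟨z₀, hz₀, hz₀F⟩ := hmem
  obtain ⟨g, hg, hgF⟩ := exists_isometryEquiv_of_eq
    (locallyIsometricAt_of_mem_ball (by positivity) h3 h4 hz₀) (h.1 y₀ hy₀) hz₀F
  have hz₀d : dist z₀ p ≤ τ := by
    rwa [← h3 z₀ hz₀ p (Metric.mem_ball_self (by positivity)), hz₀F]
  have hgball : ∀ y ∈ Metric.ball (⟨w, k, hk⟩ : HypSpace) (2 * τ), g y ∈ Metric.ball p (4 * τ) := by
    intro y hy
    rw [Metric.mem_ball] at hy ⊢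
    have t1 := dist_triangle (g y) (g y₀) p
    rw [g.dist_eq, hg] at t1
    have t2 := dist_triangle y ⟨w, k, hk⟩ y₀
    rw [dist_comm ⟨w, k, hk⟩ y₀, hy₀d] at t2
    linarith
  have hG : ∀ y ∈ Metric.ball (⟨w, k, hk⟩ : HypSpace) (2 * τ), LocallyIsometricAt hdist (Φ ∘ g) y :=
    fun y hy => locallyIsometricAt_comp g
      (locallyIsometricAt_of_mem_ball (by positivity) h3 h4 (hgball y hy))
  have heq : EqOn (Φ ∘ g) F (Metric.ball (⟨w, k, hk⟩ : HypSpace) (2 * τ) ∩ {q | k < q.height}) :=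
    eqOn_of_eventuallyEq (isPreconnected_ball_inter_setOf_lt_height _ _ _)
      (fun y hy => hG y hy.1) (fun y hy => h.1 y hy.2)
      ⟨by rw [Metric.mem_ball, hy₀d]; linarith, hy₀⟩ hgF
  refine ⟨2 * τ, by positivity, Φ ∘ g, fun y hy => ⟨hG y hy, ?_, fun hky => heq ⟨hy, hky⟩⟩⟩
  apply h2
  have := mem_image_of_mem Φ (hgball y hy)
  rw [h4] at this
  exact Metric.ball_subset_ball (hτlt.le.trans (min_le_right _ _)) this

/-- Every point of the plane is within bounded distance of the lattice. -/
lemma exists_lattice_near (U : HoroballNbhd S) : ∃ C, ∀ w : ℂ, ∃ v ∈ U.lattice, ‖w - v‖ ≤ C := by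
  have := U.discrete
  have : IsZLattice ℝ U.lattice := ⟨U.spans⟩
  let b := (Module.Free.chooseBasis ℤ U.lattice).ofZLatticeBasis ℝ U.lattice
  have : Fintype (Module.Free.ChooseBasisIndex ℤ U.lattice) := Fintype.ofFinite _
  refine ⟨∑ i, ‖b i‖, fun w => ⟨ZSpan.floor b w, ?_, ZSpan.norm_fract_le b w⟩⟩
  exact (Module.Basis.ofZLatticeBasis_span ℝ U.lattice _).le (ZSpan.floor b w).2

/-- If an extension to an open horoball extends further near each boundary point, then it extends to
a larger horoball: the local extensions agree on their overlaps, and since the lattice is cocompact,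
finitely many of them suffice up to translation. -/
lemma IsExtension.exists_lt (h : U.IsExtension k F) (hk : 0 < k)
    (hkU : k ≤ U.level) (hloc : ∀ w : ℂ, ∃ δ > 0, ∃ G : HypSpace → M, ∀ y ∈ Metric.ball ⟨w, k, hk⟩ δ,
      LocallyIsometricAt hdist G y ∧ G y ∉ S ∧ (k < y.height → G y = F y)) :
    ∃ k' F', k' < k ∧ U.IsExtension k' F' := by
  let P : HypSpace → ℝ → (HypSpace → M) → Prop := fun q δ G => q.height = k ∧
    ∀ y ∈ Metric.ball q δ, LocallyIsometricAt hdist G y ∧ G y ∉ S ∧ (k < y.height → G y = F y)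
  have agree : ∀ q δ G q' δ' G', P q δ G → P q' δ' G' → ∀ y ∈ Metric.ball q δ,
      y ∈ Metric.ball q' δ' → G y = G' y := by
    rintro q δ G q' δ' G' ⟨hq, hG⟩ ⟨hq', hG'⟩ y hy hy'
    have hδ : 0 < δ := Metric.pos_of_mem_ball hy
    have hδ' : 0 < δ' := Metric.pos_of_mem_ball hy'
    -- reflecting a point below the horosphere in it does not increase the distance to its points
    obtain ⟨z, hz, hzk⟩ : ∃ z ∈ Metric.ball q δ ∩ Metric.ball q' δ', k ≤ z.height := by
      rcases le_or_gt k y.height with hyk | hyk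
      · exact ⟨y, ⟨hy, hy'⟩, hyk⟩
      have hy0 := y.height_pos
      have refl : ∀ (q : HypSpace) (δ : ℝ), q.height = k → 0 < δ → y ∈ Metric.ball q δ →
          (⟨y.base, k ^ 2 / y.height, by positivity⟩ : HypSpace) ∈ Metric.ball q δ := by
        intro q δ hq hδ hy
        rw [Metric.mem_ball, dist_lt_iff hδ.le, hq] at hy ⊢
        have e : ‖y.base - q.base‖ ^ 2 + (k ^ 2 / y.height) ^ 2 + k ^ 2 <
            Real.cosh δ * (2 * (k ^ 2 / y.height) * k) := by
          have h1 : ‖y.base - q.base‖ ^ 2 * y.height ^ 2 ≤ ‖y.base - q.base‖ ^ 2 * k ^ 2 := by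
            gcongr
          have h2 : ‖y.base - q.base‖ ^ 2 * y.height ^ 2 + k ^ 4 + k ^ 2 * y.height ^ 2 <
              Real.cosh δ * (2 * k ^ 3 * y.height) := by
            nlinarith [mul_lt_mul_of_pos_left hy (pow_pos hk 2)]
          have h3 : ‖y.base - q.base‖ ^ 2 + (k ^ 2 / y.height) ^ 2 + k ^ 2 =
              (‖y.base - q.base‖ ^ 2 * y.height ^ 2 + k ^ 4 + k ^ 2 * y.height ^ 2) /
                y.height ^ 2 := by
            field_simp
          have h4 : Real.cosh δ * (2 * (k ^ 2 / y.height) * k) =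
              (Real.cosh δ * (2 * k ^ 3 * y.height)) / y.height ^ 2 := by
            field_simp
          rw [h3, h4]
          gcongr
        exact e
      refine ⟨_, ⟨refl q δ hq hδ hy, refl q' δ' hq' hδ' hy'⟩, ?_⟩
      show k ≤ k ^ 2 / y.height
      rw [le_div_iff₀ hy0]
      nlinarith
    obtain ⟨η, hη, hz', -⟩ := exists_frame (Metric.isOpen_ball.inter Metric.isOpen_ball) hz
    have hk' : k < z.height + η := by linarith
    refine eqOn_of_eventuallyEq (isPreconnected_ball_inter_ball q q' δ δ')
      (fun y hy => (hG y hy.1).1) (fun y hy => (hG' y hy.2).1) hz' ?_ ⟨hy, hy'⟩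
    filter_upwards [Metric.isOpen_ball.mem_nhds hz'.1, Metric.isOpen_ball.mem_nhds hz'.2,
      (isOpen_setOf_lt_height k).mem_nhds hk'] with a ha ha' hak
    rw [(hG a ha).2.2 hak, (hG' a ha').2.2 hak]
  have hex : ∀ y : HypSpace, ∃ z, (k < y.height → F y = z) ∧
      ∀ q δ G, P q δ G → y ∈ Metric.ball q δ → G y = z := by
    intro y
    by_cases hy : k < y.height
    · exact ⟨F y, fun _ => rfl, fun q δ G hP hyq => (hP.2 y hyq).2.2 hy⟩
    by_cases hy' : ∃ q δ G, P q δ G ∧ y ∈ Metric.ball q δ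
    · obtain ⟨q, δ, G, hP, hyq⟩ := hy'
      exact ⟨G y, fun h => absurd h hy, fun q' δ' G' hP' hyq' =>
        agree _ _ _ _ _ _ hP' hP y hyq' hyq⟩
    · exact ⟨F y, fun _ => rfl, fun q δ G hP hyq => absurd ⟨q, δ, G, hP, hyq⟩ hy'⟩
  choose F' hF'1 hF'2 using hex
  let V : Set HypSpace := {y | ∃ q δ G, P q δ G ∧ y ∈ Metric.ball q δ}
  have hV : IsOpen V := by
    rw [isOpen_iff_mem_nhds]
    rintro y ⟨q, δ, G, hP, hy⟩
    filter_upwards [Metric.isOpen_ball.mem_nhds hy] with z hz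
    exact ⟨q, δ, G, hP, hz⟩
  have hVtrans : ∀ y ∈ V, ∀ v ∈ U.lattice, y.translate v ∈ V := by
    rintro y ⟨q, δ, G, hP, hy⟩ v hv
    have hball : ∀ z, z ∈ Metric.ball (q.translate v) δ →
        (translateEquiv v).symm z ∈ Metric.ball q δ := by
      intro z hz
      rwa [Metric.mem_ball, ← (translateEquiv v).dist_eq, IsometryEquiv.apply_symm_apply]
    refine ⟨q.translate v, δ, G ∘ (translateEquiv v).symm, ⟨hP.1, fun z hz => ?_⟩, ?_⟩
    · obtain ⟨h1, h2, h3⟩ := hP.2 _ (hball z hz)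
      refine ⟨locallyIsometricAt_comp _ h1, h2, fun hz' => ?_⟩
      rw [Function.comp_apply, h3 hz', translateEquiv_symm_apply,
        h.translate (U.lattice.neg_mem hv) hz']
    · rw [Metric.mem_ball]
      exact ((translateEquiv v).dist_eq y q).trans_lt hy
  -- by compactness, `V` contains a slab below the horosphere
  obtain ⟨C, hC⟩ := U.exists_lattice_near
  have hn : IsOpen {x : ℂ × ℝ | ∃ hx : 0 < x.2, (⟨x.1, x.2, hx⟩ : HypSpace) ∈ V} := by
    have h1 : IsOpen {x : ℂ × ℝ | 0 < x.2} := isOpen_lt continuous_const continuous_snd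
    have h2 := h1.isOpenMap_subtype_val _ (hV.preimage (continuous_mk
      (X := {x : ℂ × ℝ | 0 < x.2}) (f := fun x => x.1.1) (g := fun x => x.1.2) (by fun_prop)
      (by fun_prop) (fun x => x.2)))
    convert h2
    ext x
    constructor
    · rintro ⟨hx, hx'⟩
      exact ⟨⟨x, hx⟩, hx', rfl⟩
    · rintro ⟨⟨x, hx⟩, hx', rfl⟩
      exact ⟨hx, hx'⟩
  obtain ⟨u, v, -, hv, hu, hkv, huv⟩ := generalized_tube_lemma
    (isCompact_closedBall (0 : ℂ) C) (isCompact_singleton (x := k)) hn (by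
      rintro ⟨w, s⟩ ⟨-, hs⟩
      obtain rfl : s = k := hs
      obtain ⟨δ, hδ, G, hG⟩ := hloc w
      exact ⟨hk, _, δ, G, ⟨rfl, hG⟩, Metric.mem_ball_self hδ⟩)
  obtain ⟨η, hη, hηv⟩ := Metric.isOpen_iff.1 hv k (hkv rfl)
  have hslab : ∀ y : HypSpace, k - η < y.height → y.height ≤ k → y ∈ V := by
    intro y hy1 hy2
    obtain ⟨a, ha, hya⟩ := hC y.base
    have h1 : ((y.translate (-a)).base, y.height) ∈ u ×ˢ v := by
      refine ⟨hu ?_, hηv ?_⟩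
      · simpa [← sub_eq_add_neg] using hya
      · rw [Metric.mem_ball, Real.dist_eq, abs_lt]
        constructor <;> linarith
    obtain ⟨_, h2⟩ := huv h1
    have h3 := hVtrans _ h2 a ha
    convert h3
    simp [HypSpace.eq_iff_base_height]
  have hcase : ∀ y : HypSpace, k - η < y.height → ∃ G, LocallyIsometricAt hdist G y ∧ G y ∉ S ∧
      G =ᶠ[𝓝 y] F' := by
    intro y hy
    rcases lt_or_ge k y.height with hy' | hy'
    · refine ⟨F, h.1 y hy', h.2 y hy', ?_⟩
      filter_upwards [(isOpen_setOf_lt_height k).mem_nhds hy'] with z hz using hF'1 z hz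
    · obtain ⟨q, δ, G, hP, hyq⟩ := hslab y hy hy'
      refine ⟨G, (hP.2 y hyq).1, (hP.2 y hyq).2.1, ?_⟩
      filter_upwards [Metric.isOpen_ball.mem_nhds hyq] with z hz using hF'2 z q δ G hP hz
  refine ⟨k - η, F', by linarith, fun y hy => ?_, fun y hy => ?_,
    fun y hy => by rw [← hF'1 y (hkU.trans_lt hy), h.3 y hy]⟩
  · obtain ⟨G, h1, -, h3⟩ := hcase y hy
    exact locallyIsometricAt_congr h1 h3
  · obtain ⟨G, -, h2, h3⟩ := hcase y hy
    rwa [← h3.eq_of_nhds]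

end HoroballNbhd

namespace HypSpace

/-- The point at time `t` of the geodesic which is the semicircle of radius `a` centered at `u`,
over the line spanned by the unit vector `e`. -/
noncomputable def semicircle (u e : ℂ) (a : ℝ) (ha : 0 < a) (t : ℝ) : HypSpace :=
  ⟨u + (a * Real.tanh t) • e, a / Real.cosh t, div_pos ha (Real.cosh_pos t)⟩

lemma dist_semicircle (u : ℂ) {e : ℂ} (he : ‖e‖ = 1) (a : ℝ) (ha : 0 < a) (s t : ℝ) :
    dist (semicircle u e a ha s) (semicircle u e a ha t) = |s - t| := by
  apply dist_eq_of_cosh_eq (abs_nonneg _)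
  have hs := Real.cosh_pos s
  have ht := Real.cosh_pos t
  have h1 := Real.cosh_sq s
  have h2 := Real.cosh_sq t
  rw [Real.cosh_abs, Real.cosh_sub]
  simp only [semicircle, add_sub_add_left_eq_sub, ← sub_smul, norm_smul, he, mul_one,
    Real.norm_eq_abs, sq_abs, Real.tanh_eq_sinh_div_cosh]
  field_simp
  linear_combination -Real.cosh t ^ 2 * h1 - Real.cosh s ^ 2 * h2

end HypSpace

namespace HoroballNbhd

open HypSpace

variable {M : Type*} [MetricSpace M] {S : Set M}
variable {U : HoroballNbhd S} {k k' : ℝ} {F F' : HypSpace → M}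

/-- If a boundary point of an extension, at height `k`, is mapped to the singular locus, then so is
its translate by a lattice vector `v`, and the geodesic which joins the two points has length `2 T`
with `sinh T = |v| / (2 k)`. Its image leaves every embedded tube, so the tube radius is at most
`T`. -/
theorem IsExtension.limit_notMem (h : U.IsExtension k F) (hk : 0 < k) {w : ℂ} {x : M}
    (hx : ∀ q, k < q.height → dist (F q) x ≤ ‖q.base - w‖ / k + (Real.log q.height - Real.log k))
    {v : ℂ} (hv : v ∈ U.lattice) (hv0 : v ≠ 0) {r : ℝ} (hS : HasEmbeddedTube S r)
    (hr : Real.arsinh (‖v‖ / (2 * k)) < r) : x ∉ S := by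
  intro hxS
  have hvpos : 0 < ‖v‖ := norm_pos_iff.2 hv0
  set T := Real.arsinh (‖v‖ / (2 * k)) with hT_def
  have hsinh : Real.sinh T = ‖v‖ / (2 * k) := Real.sinh_arsinh _
  have hT : 0 < T := Real.sinh_pos_iff.1 (by rw [hsinh]; positivity)
  have hx' : ∀ q, k < q.height →
      dist (F q) x ≤ ‖q.base - (w + v)‖ / k + (Real.log q.height - Real.log k) := by
    intro q hq
    have := hx (q.translate (-v)) hq
    rwa [h.translate (U.lattice.neg_mem hv) hq, base_translate, height_translate,
      show q.base + -v - w = q.base - (w + v) by ring] at this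
  let e : ℂ := (1 / ‖v‖ : ℝ) • v
  have he : ‖e‖ = 1 := by
    rw [norm_smul, Real.norm_of_nonneg (by positivity)]
    field_simp
  have ha : 0 < k * Real.cosh T := mul_pos hk (Real.cosh_pos T)
  let γ : ℝ → HypSpace := semicircle (w + (1 / 2 : ℝ) • v) e (k * Real.cosh T) ha
  have hγd : ∀ s t, dist (γ s) (γ t) = |s - t| := dist_semicircle _ he _ ha
  have hγ : Continuous γ := (Isometry.of_dist_eq hγd).continuous
  have htanh : (k * Real.cosh T * Real.tanh T) * (1 / ‖v‖) = 1 / 2 := by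
    have := Real.cosh_pos T
    rw [Real.tanh_eq_sinh_div_cosh, hsinh]
    field_simp
  have hγr : (γ T).base = w + v := by
    simp only [γ, semicircle, e, smul_smul, htanh]
    rw [add_assoc, ← add_smul]
    norm_num
  have hγl : (γ (-T)).base = w := by
    simp only [γ, semicircle, e, smul_smul, Real.tanh_neg, mul_neg, neg_mul, htanh]
    rw [add_assoc, ← add_smul]
    norm_num
  have hγh : ∀ t, |t| < T → k < (γ t).height := by
    intro t ht
    simp only [γ, semicircle]
    rw [lt_div_iff₀ (Real.cosh_pos t)]
    have : Real.cosh t < Real.cosh T := Real.cosh_lt_cosh.2 (by rwa [abs_of_pos hT])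
    gcongr
  have hγT : (γ T).height = k := by
    simp only [γ, semicircle]
    exact mul_div_cancel_right₀ _ (Real.cosh_pos T).ne'
  have hγT' : (γ (-T)).height = k := by
    simp only [γ, semicircle, Real.cosh_neg]
    exact mul_div_cancel_right₀ _ (Real.cosh_pos T).ne'
  let c : ℝ → M := fun t => if |t| < T then F (γ t) else x
  have hcin : ∀ t, |t| < T → c t = F (γ t) := fun t ht => if_pos ht
  have hcout : ∀ t, ¬ |t| < T → c t = x := fun t ht => if_neg ht
  have hcev : ∀ t, |t| < T → c =ᶠ[𝓝 t] F ∘ γ := by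
    intro t ht
    filter_upwards [(isOpen_lt continuous_abs continuous_const).mem_nhds ht] with s hs
    exact hcin s hs
  have hTT : ¬ |T| < T := by rw [abs_of_pos hT]; exact lt_irrefl T
  have hTT' : ¬ |(-T)| < T := by rwa [abs_neg]
  -- both ends of the curve converge to `x`
  have hend : ∀ (t : ℝ) (w' : ℂ), ¬ |t| < T → (γ t).base = w' → (γ t).height = k →
      (∀ q, k < q.height →
        dist (F q) x ≤ ‖q.base - w'‖ / k + (Real.log q.height - Real.log k)) →
      ContinuousWithinAt c (Icc (-T) T) t := by
    intro t w' ht hb hh hx'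
    rw [ContinuousWithinAt, hcout t ht, tendsto_iff_dist_tendsto_zero]
    have hcont : Continuous fun s =>
        ‖(γ s).base - w'‖ / k + |Real.log (γ s).height - Real.log k| := by
      have h1 := continuous_base.comp hγ
      have h2 := (continuous_height.comp hγ).log fun s => (γ s).height_pos.ne'
      simp only [Function.comp_def] at h1 h2
      fun_prop
    refine squeeze_zero (g := fun s => ‖(γ s).base - w'‖ / k +
      |Real.log (γ s).height - Real.log k|) (fun _ => dist_nonneg) (fun s => ?_) ?_
    · by_cases hs : |s| < T
      · rw [hcin s hs]
        exact (hx' _ (hγh s hs)).trans (by gcongr; exact le_abs_self _)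
      · rw [hcout s hs, dist_self]
        positivity
    · have := (hcont.tendsto t).mono_left (nhdsWithin_le_nhds (s := Icc (-T) T))
      simpa [hb, hh] using this
  have hcc : ContinuousOn c (Icc (-T) T) := by
    intro t ht
    by_cases htT : |t| < T
    · refine ContinuousAt.continuousWithinAt (ContinuousAt.congr ?_ (hcev t htT).symm)
      exact (continuousAt_of_locallyIsometricAt (h.1 _ (hγh t htT))).comp hγ.continuousAt
    · rcases eq_or_eq_neg_of_abs_eq (le_antisymm (abs_le.2 ht) (not_lt.1 htT)) with rfl | rfl
      · exact hend _ _ htT hγr hγT hx'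
      · exact hend _ _ htT hγl hγT' hx
  have hlip : ∀ s ∈ Ioo (-T) T, ∀ t ∈ Icc (-T) T, dist (c s) (c t) ≤ |s - t| := by
    intro s hs t ht
    rw [← closure_Ioo (by linarith : -T ≠ T)] at ht hcc
    refine le_on_closure (f := fun t => dist (c s) (c t)) (g := fun t => |s - t|)
      (fun t ht => ?_) (by fun_prop) (by fun_prop) ht
    have key : ∀ a ∈ Ioo (-T) T, ∀ b ∈ Ioo (-T) T, a ≤ b → dist (c a) (c b) ≤ b - a := by
      intro a ha b hb hab
      rw [hcin a (abs_lt.2 ha), hcin b (abs_lt.2 hb)]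
      have := dist_comp_le (F := F) (γ := γ) (K := 1) hab
        (fun s t => by rw [hγd, one_mul]) (fun t ht => h.1 _ (hγh t
          (abs_lt.2 ⟨ha.1.trans_le ht.1, ht.2.trans_lt hb.2⟩)))
      linarith
    rcases le_total s t with hst | hst
    · rw [abs_sub_comm, abs_of_nonneg (sub_nonneg.2 hst)]
      exact key s hs t ht hst
    · rw [dist_comm, abs_of_nonneg (sub_nonneg.2 hst)]
      exact key t ht s hs hst
  refine hS.not_return hT hcc (by rwa [hcout _ hTT']) (by rwa [hcout _ hTT]) ?_ ?_ ?_
  · intro t ht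
    rw [Metric.mem_thickening_iff]
    refine ⟨x, hxS, ?_⟩
    by_cases htT : |t| < T
    · have h1 := hlip t (abs_lt.1 htT) T (right_mem_Icc.2 (by linarith))
      have h2 := hlip t (abs_lt.1 htT) (-T) (left_mem_Icc.2 (by linarith))
      rw [hcout _ hTT, abs_sub_comm, abs_of_nonneg (by linarith [ht.2])] at h1
      rw [hcout _ hTT', abs_of_nonneg (by linarith [ht.1])] at h2
      linarith
    · rw [hcout t htT, dist_self]
      linarith
  · intro t ht
    rw [hcin t (abs_lt.2 ht)]
    exact h.2 _ (hγh t (abs_lt.2 ht))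
  · intro t ht
    obtain ⟨ε, hε, h1⟩ := exists_forall_ball_of_locallyIsometricAt (h.1 _ (hγh t (abs_lt.2 ht)))
    have ev : ∀ᶠ s in 𝓝 t, c s = F (γ s) ∧ γ s ∈ Metric.ball (γ t) ε :=
      (hcev t (abs_lt.2 ht)).and (hγ.continuousAt.eventually_mem (Metric.ball_mem_nhds _ hε))
    rw [nhds_prod_eq]
    filter_upwards [ev.prod_mk ev] with s hs
    rw [hs.1.1, hs.2.1, (h1 ε hε le_rfl).1 _ hs.1.2 _ hs.2.2, hγd]

/-- If the tube radius about the singular locus is at least `R`, then the parametrization of a cusp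
extends to the level `|v| / (2 sinh R)`, for every nonzero lattice vector `v`. -/
theorem exists_isExtension (hM : IsHyperbolicConeManifold M S) (U : HoroballNbhd S) {R : ℝ}
    (hR : 0 < R) (hRS : ENNReal.ofReal R ≤ tubeRadius S) {v : ℂ} (hv : v ∈ U.lattice)
    (hv0 : v ≠ 0) : ∃ F, U.IsExtension (‖v‖ / (2 * Real.sinh R)) F := by
  have := hM.complete
  have hsinh : 0 < Real.sinh R := Real.sinh_pos_iff.2 hR
  have hvpos : 0 < ‖v‖ := norm_pos_iff.2 hv0
  set k₁ := ‖v‖ / (2 * Real.sinh R) with hk₁_def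
  have hk₁ : 0 < k₁ := by positivity
  by_contra hno
  let E : Set ℝ := {k | ∃ F, U.IsExtension k F}
  have hE : ∀ k ∈ E, k₁ < k := by
    rintro k ⟨F, hF⟩
    by_contra! hle
    exact hno ⟨F, hF.mono hle⟩
  have hEne : E.Nonempty := ⟨U.level, U.param, U.isExtension_param⟩
  have hEb : BddBelow E := ⟨k₁, fun k hk => (hE k hk).le⟩
  have hk₁le : k₁ ≤ sInf E := le_csInf hEne fun k hk => (hE k hk).le
  have hkpos : 0 < sInf E := hk₁.trans_le hk₁le
  -- the extensions to the levels above the infimum fit together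
  obtain ⟨F, hF⟩ : sInf E ∈ E := by
    have hex : ∀ y : HypSpace, ∃ z, ∀ k G, U.IsExtension k G → k < y.height → G y = z := by
      intro y
      by_cases hy : ∃ k G, U.IsExtension k G ∧ k < y.height
      · obtain ⟨k, G, hG, hky⟩ := hy
        exact ⟨G y, fun k' G' hG' hky' =>
          (hG'.mono (le_max_right k k')).eqOn (hG.mono (le_max_left k k')) (max_lt hky hky')⟩
      · exact ⟨U.param y, fun k G hG hky => absurd ⟨k, G, hG, hky⟩ hy⟩
    choose F hF using hex
    have hloc : ∀ y : HypSpace, sInf E < y.height → ∃ k G, U.IsExtension k G ∧ k < y.height ∧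
        G =ᶠ[𝓝 y] F := by
      intro y hy
      obtain ⟨k, ⟨G, hG⟩, hky⟩ := exists_lt_of_csInf_lt hEne hy
      refine ⟨k, G, hG, hky, ?_⟩
      filter_upwards [(isOpen_setOf_lt_height k).mem_nhds hky] with z hz using hF z k G hG hz
    refine ⟨F, fun y hy => ?_, fun y hy => ?_, fun y hy => ?_⟩
    · obtain ⟨k, G, hG, hky, hGF⟩ := hloc y hy
      exact locallyIsometricAt_congr (hG.1 y hky) hGF
    · obtain ⟨k, G, hG, hky, hGF⟩ := hloc y hy
      rw [← hGF.eq_of_nhds]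
      exact hG.2 y hky
    · exact (hF y _ _ U.isExtension_param hy).symm
  have hlt : k₁ < sInf E := hE _ ⟨F, hF⟩
  obtain ⟨r, hr, hrS⟩ : ∃ r, Real.arsinh (‖v‖ / (2 * sInf E)) < r ∧ HasEmbeddedTube S r := by
    have h1 : Real.arsinh (‖v‖ / (2 * sInf E)) < R := by
      rw [← Real.sinh_lt_sinh, Real.sinh_arsinh, div_lt_iff₀ (by positivity)]
      rw [hk₁_def, div_lt_iff₀ (by positivity)] at hlt
      linarith
    have h2 : ENNReal.ofReal (Real.arsinh (‖v‖ / (2 * sInf E))) < tubeRadius S :=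
      ((ENNReal.ofReal_lt_ofReal_iff hR).2 h1).trans_le hRS
    simp only [tubeRadius, lt_iSup_iff] at h2
    obtain ⟨r, hr, hS, hlt⟩ := h2
    exact ⟨r, (ENNReal.ofReal_lt_ofReal_iff hr).1 hlt, hS⟩
  obtain ⟨k', F', hk', hF'⟩ := hF.exists_lt hkpos (csInf_le hEb ⟨U.param, U.isExtension_param⟩)
    fun w => by
      obtain ⟨x, hx⟩ := hF.exists_limit hkpos w
      exact hF.exists_local_extension hM hkpos hx (hF.limit_notMem hkpos hx hv hv0 hrS hr)
  exact hk'.not_ge (csInf_le hEb ⟨F', hF'⟩)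

end HoroballNbhd

/-! ### Injectivity of the extension -/

namespace HypSpace

lemma isPreconnected_setOf_lt_height_and (g : HypSpace ≃ᵢ HypSpace) {k : ℝ} (hk : 0 ≤ k) :
    IsPreconnected {x : HypSpace | k < x.height ∧ k < (g x).height} := by
  rcases height_isometryEquiv g with ⟨μ, -, hg⟩ | ⟨C, hC, w₀, hg⟩
  · convert isPreconnected_setOf_and le_rfl le_rfl k k 1 μ 0 0 using 1
    ext x
    simp [hg]
  · convert isPreconnected_setOf_and le_rfl hk k 0 1 C 0 w₀ using 1
    ext x
    have := x.height_pos
    have hpos : 0 < ‖x.base - w₀‖ ^ 2 + x.height ^ 2 := by positivity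
    simp [← hg, mul_lt_mul_iff_left₀ hpos]

end HypSpace

namespace HoroballNbhd

open HypSpace

variable {M : Type*} [MetricSpace M] {S : Set M}
variable {U : HoroballNbhd S} {k k' : ℝ} {F F' : HypSpace → M}

/-- An isometry `g` of hyperbolic space is a deck transformation of the local isometry `F` on the
horoball of level `k` if `F (g x) = F x` whenever both `x` and `g x` belong to this horoball. It is
exotic if it is not one of the translations by lattice vectors. -/
structure IsExoticDeck (U : HoroballNbhd S) (k : ℝ) (F : HypSpace → M)
    (g : HypSpace ≃ᵢ HypSpace) : Prop where
  apply_eq : ∀ x, k < x.height → k < (g x).height → F (g x) = F x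
  ne_translate : ∀ v ∈ U.lattice, ¬ ∀ x, g x = x.translate v

/-- An isometry under which the germ of `F` at one point is invariant is a deck transformation. -/
lemma IsExtension.apply_eq_of_eventuallyEq (h : U.IsExtension k F) (hk : 0 ≤ k)
    {g : HypSpace ≃ᵢ HypSpace} {q : HypSpace} (hq : k < q.height) (hgq : k < (g q).height)
    (hg : F ∘ g =ᶠ[𝓝 q] F) (x : HypSpace) (hx : k < x.height) (hgx : k < (g x).height) :
    F (g x) = F x :=
  eqOn_of_eventuallyEq (isPreconnected_setOf_lt_height_and g hk)
    (fun _ hy => locallyIsometricAt_comp g (h.1 _ hy.2)) (fun _ hy => h.1 _ hy.1)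
    (a := q) ⟨hq, hgq⟩ hg ⟨hx, hgx⟩

lemma exists_pos_forall_norm_lt (U : HoroballNbhd S) :
    ∃ ε > 0, ∀ v ∈ U.lattice, ‖v‖ < ε → v = 0 := by
  have := U.discrete
  obtain ⟨ε, hε, h⟩ := Metric.isOpen_iff.1 (isOpen_discrete ({0} : Set U.lattice)) 0 rfl
  refine ⟨ε, hε, fun v hv hvε => ?_⟩
  have h1 : (⟨v, hv⟩ : U.lattice) ∈ Metric.ball 0 ε := by
    rw [Metric.mem_ball, Subtype.dist_eq, dist_eq_norm]
    simpa using hvε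
  simpa using h h1

/-- An exotic deck transformation moves the embedded horoball off itself. -/
lemma IsExoticDeck.height_le (h : U.IsExtension k F) (hk : k ≤ U.level)
    {g : HypSpace ≃ᵢ HypSpace} (hg : U.IsExoticDeck k F g) (x : HypSpace)
    (hx : U.level < x.height) : (g x).height ≤ U.level := by
  by_contra! hgx
  have key : ∀ y : HypSpace, U.level < y.height → U.level < (g y).height →
      (g y).base - y.base ∈ U.lattice ∧ g y = y.translate ((g y).base - y.base) := by
    intro y hy hgy
    have h1 := hg.apply_eq y (hk.trans_lt hy) (hk.trans_lt hgy)
    rw [h.3 _ hy, h.3 _ hgy] at h1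
    obtain ⟨v, hv, hv'⟩ := (U.param_eq_iff y (g y) hy hgy).1 h1.symm
    have : (g y).base - y.base = v := by rw [hv', base_translate, add_sub_cancel_left]
    rw [this]
    exact ⟨hv, hv'⟩
  obtain ⟨ε, hε, hdisc⟩ := U.exists_pos_forall_norm_lt
  refine hg.ne_translate _ (key x hx hgx).1 fun z => ?_
  refine isometryEquiv_ext (g' := translateEquiv _) (p := x) ?_ z
  have hc : Continuous fun y => ((g y).base - y.base) - ((g x).base - x.base) := by
    have := continuous_base.comp g.continuous
    have := continuous_base
    simp only [Function.comp_def] at *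
    fun_prop
  have h1 : ∀ᶠ y in 𝓝 x, ‖((g y).base - y.base) - ((g x).base - x.base)‖ < ε :=
    hc.norm.continuousAt.eventually (gt_mem_nhds (by simpa using hε))
  filter_upwards [h1, (isOpen_setOf_lt_height U.level).mem_nhds hx,
    ((isOpen_setOf_lt_height U.level).preimage g.continuous).mem_nhds hgx] with y hy1 hy2 hy3
  obtain ⟨k1, k2⟩ := key y hy2 hy3
  rw [translateEquiv_apply, ← sub_eq_zero.1 (hdisc _ (U.lattice.sub_mem k1 (key x hx hgx).1) hy1)]
  exact k2

/-- The iteration step of the Shimizu–Leutbecher argument: if the exotic deck transformation `g`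
overlaps the horoball of level `t > |v|` with itself, then `g⁻¹ τ g`, where `τ` is the translation
by `v`, overlaps the smaller horoball of level `t² / |v|` with itself. It is a deck
transformation, because the local isometry `F` is defined at a common point of the three horoballs
of level `k` based at `∞`, `g ∞` and `g ∞ + v`. -/
lemma IsExoticDeck.exists_of_overlap (h : U.IsExtension k F) (hk0 : 0 < k) (hk : k ≤ U.level)
    {v : ℂ} (hv : v ∈ U.lattice) (hv0 : v ≠ 0) {t : ℝ} (ht : 0 < t)
    (hkt : ‖v‖ ^ 2 / 4 + k ^ 2 < t ^ 2) {g : HypSpace ≃ᵢ HypSpace} (hg : U.IsExoticDeck k F g)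
    {x : HypSpace} (hx : t ≤ x.height) (hgx : t ≤ (g x).height) :
    ∃ g' : HypSpace ≃ᵢ HypSpace, U.IsExoticDeck k F g' ∧
      ∃ y : HypSpace, t ^ 2 / ‖v‖ ≤ y.height ∧ t ^ 2 / ‖v‖ ≤ (g' y).height := by
  have hvpos : 0 < ‖v‖ := norm_pos_iff.2 hv0
  rcases height_isometryEquiv g.symm with ⟨μ, hμ, hs⟩ | ⟨C, hC, w₀, hs⟩
  · -- an isometry which fixes `∞` overlaps the embedded horoball with itself
    exfalso
    have hl := U.level_pos
    have hpos : 0 < U.level + 1 + (U.level + 1) / μ := by positivity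
    let y : HypSpace := ⟨0, U.level + 1 + (U.level + 1) / μ, hpos⟩
    have h1 : U.level < (g.symm y).height := by
      rw [hs]
      show U.level < μ * (U.level + 1 + (U.level + 1) / μ)
      rw [mul_add, mul_div_cancel₀ _ hμ.ne']
      nlinarith
    have h2 := hg.height_le h hk _ h1
    rw [g.apply_symm_apply] at h2
    have h3 : U.level + 1 + (U.level + 1) / μ ≤ U.level := h2
    have h4 : 0 < (U.level + 1) / μ := by positivity
    linarith
  have hCt : t ^ 2 ≤ C := by
    have h1 := hs (g x)
    rw [g.symm_apply_apply] at h1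
    have h2 := (g x).height_pos
    have h3 : x.height * (g x).height ≤ C := by
      have : x.height * (g x).height * (g x).height ≤ C * (g x).height := by
        rw [← h1]
        nlinarith [mul_nonneg x.height_pos.le (sq_nonneg (‖(g x).base - w₀‖))]
      exact le_of_mul_le_mul_right this h2
    nlinarith
  let g' : HypSpace ≃ᵢ HypSpace := (g.trans (translateEquiv v)).trans g.symm
  have hg' : ∀ y, g' y = g.symm ((g y).translate v) := fun y => rfl
  have hhalf : ∀ a : ℝ, ‖w₀ - (1 / 2 : ℝ) • v - w₀‖ ^ 2 + a ^ 2 = ‖v‖ ^ 2 / 4 + a ^ 2 := fun a => by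
    rw [sub_sub_cancel_left, norm_neg, norm_smul, Real.norm_of_nonneg (by positivity)]
    ring
  have hhalf' : ∀ a : ℝ, ‖w₀ - (1 / 2 : ℝ) • v + v - w₀‖ ^ 2 + a ^ 2 = ‖v‖ ^ 2 / 4 + a ^ 2 :=
    fun a => by
    rw [show w₀ - (1 / 2 : ℝ) • v + v - w₀ = (1 / 2 : ℝ) • v by
      module, norm_smul,
      Real.norm_of_nonneg (by positivity)]
    ring
  -- the points midway between the base points `g ∞` and `g ∞ + v`, as seen from `g ∞ + v / 2`
  have hmid : ∀ (s : ℝ) (hs0 : 0 < s),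
      (g.symm ⟨w₀ - (1 / 2 : ℝ) • v, s, hs0⟩).height = C * s / (‖v‖ ^ 2 / 4 + s ^ 2) ∧
      (g.symm (translate v ⟨w₀ - (1 / 2 : ℝ) • v, s, hs0⟩)).height =
        C * s / (‖v‖ ^ 2 / 4 + s ^ 2) := by
    intro s hs0
    have hpos : 0 < ‖v‖ ^ 2 / 4 + s ^ 2 := by positivity
    constructor
    · rw [eq_div_iff hpos.ne', ← hhalf s]
      exact hs _
    · rw [eq_div_iff hpos.ne', ← hhalf' s]
      exact hs (translate v ⟨w₀ - (1 / 2 : ℝ) • v, s, hs0⟩)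
  refine ⟨g', ⟨?_, ?_⟩, ?_⟩
  · -- a common point of the three horoballs
    obtain ⟨s, hks, hsC⟩ : ∃ s, k < s ∧ ‖v‖ ^ 2 / 4 + s ^ 2 < C := by
      obtain ⟨s, hs1, hs2⟩ := exists_between
        (show k < Real.sqrt (C - ‖v‖ ^ 2 / 4) from Real.lt_sqrt_of_sq_lt (by linarith))
      refine ⟨s, hs1, ?_⟩
      have := (Real.lt_sqrt (hk0.trans hs1).le).1 hs2
      linarith
    have hs0 := hk0.trans hks
    have hlt : k < C * s / (‖v‖ ^ 2 / 4 + s ^ 2) := by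
      rw [lt_div_iff₀ (by positivity)]
      nlinarith [mul_lt_mul_of_pos_left hsC hk0]
    obtain ⟨m1, m2⟩ := hmid s hs0
    set y : HypSpace := ⟨w₀ - (1 / 2 : ℝ) • v, s, hs0⟩ with hy
    have e1 : k < (g.symm y).height := by rwa [m1]
    have e2 : k < (g' (g.symm y)).height := by rwa [hg', g.apply_symm_apply, m2]
    have e3 : k < (g (g.symm y)).height := by rwa [g.apply_symm_apply]
    refine h.apply_eq_of_eventuallyEq hk0.le e1 e2 ?_
    filter_upwards [(isOpen_setOf_lt_height k).mem_nhds e1,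
      ((isOpen_setOf_lt_height k).preimage g'.continuous).mem_nhds e2,
      ((isOpen_setOf_lt_height k).preimage g.continuous).mem_nhds e3] with z hz1 hz2 hz3
    have hz3 : k < (g z).height := hz3
    have hz4 : g (g' z) = (g z).translate v := by rw [hg', g.apply_symm_apply]
    rw [Function.comp_apply, ← hg.apply_eq (g' z) hz2 (by rwa [hz4]), hz4, h.translate hv hz3,
      hg.apply_eq z hz1 hz3]
  · intro u _ hu
    have h1 := hs ⟨w₀, 1, one_pos⟩
    have h2 := hs (translate v ⟨w₀, 1, one_pos⟩)
    have h3 := hu (g.symm ⟨w₀, 1, one_pos⟩)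
    rw [hg', g.apply_symm_apply] at h3
    rw [h3] at h2
    simp only [height_translate, base_translate, sub_self, norm_zero, add_sub_cancel_left] at h1 h2
    have h4 := (g.symm ⟨w₀, 1, one_pos⟩).height_pos
    have h5 : 0 < (g.symm ⟨w₀, 1, one_pos⟩).height * ‖v‖ ^ 2 := by positivity
    linarith
  · have hhv : 0 < ‖v‖ / 2 := by positivity
    obtain ⟨m1, m2⟩ := hmid (‖v‖ / 2) hhv
    have e : C * (‖v‖ / 2) / (‖v‖ ^ 2 / 4 + (‖v‖ / 2) ^ 2) = C / ‖v‖ := by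
      field_simp
      ring
    refine ⟨g.symm ⟨w₀ - (1 / 2 : ℝ) • v, ‖v‖ / 2, hhv⟩, ?_, ?_⟩
    · rw [m1, e]
      gcongr
    · rw [hg', g.apply_symm_apply, m2, e]
      gcongr

/-- The extension is injective modulo the lattice above the level `l`, if `l` is at least the
length of a lattice vector and the extension is defined down to a level `k ≤ (√3 / 2) l`. This is
the height at which two hemispheres of radius `l` meet whose centers are at distance `l`. If
injectivity fails, there is an exotic deck transformation which overlaps the horoball of some
level `t > l` with itself, and the iteration of `IsExoticDeck.exists_of_overlap` leads to one
which overlaps the embedded horoball with itself. -/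
theorem IsExtension.exists_translate_of_eq (h : U.IsExtension k F) (hk0 : 0 < k)
    (hk : k ≤ U.level) {l : ℝ} (hkl : k ≤ l) {v : ℂ} (hv : v ∈ U.lattice) (hv0 : v ≠ 0)
    (hvl : ‖v‖ ≤ l) (hkl' : 4 * k ^ 2 ≤ 3 * l ^ 2) {p q : HypSpace} (hp : l < p.height)
    (hq : l < q.height) (hpq : F p = F q) : ∃ u ∈ U.lattice, q = p.translate u := by
  by_contra hno
  have hvpos : 0 < ‖v‖ := norm_pos_iff.2 hv0
  have hkp := hkl.trans_lt hp
  have hkq := hkl.trans_lt hq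
  obtain ⟨g, hgq, hg⟩ := exists_isometryEquiv_of_eq (h.1 p hkp) (h.1 q hkq) hpq
  have hdeck : U.IsExoticDeck k F g := by
    refine ⟨h.apply_eq_of_eventuallyEq hk0.le hkq (by rwa [hgq]) hg, fun u hu hgu => hno
      ⟨-u, U.lattice.neg_mem hu, ?_⟩⟩
    rw [← hgq, hgu]
    exact HypSpace.eq_iff_base_height.2 ⟨by simp, rfl⟩
  set t := min p.height q.height with ht_def
  have hlt : l < t := lt_min hp hq
  have hl0 : 0 < l := hvpos.trans_le hvl
  have h1 : 1 < t / ‖v‖ := (one_lt_div hvpos).2 (hvl.trans_lt hlt)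
  have key : ∀ n : ℕ, ∃ g : HypSpace ≃ᵢ HypSpace, U.IsExoticDeck k F g ∧
      ∃ y : HypSpace, t * (t / ‖v‖) ^ n ≤ y.height ∧ t * (t / ‖v‖) ^ n ≤ (g y).height := by
    intro n
    induction n with
    | zero =>
      refine ⟨g, hdeck, q, ?_, ?_⟩
      · rw [pow_zero, mul_one]
        exact min_le_right _ _
      · rw [hgq, pow_zero, mul_one]
        exact min_le_left _ _
    | succ n ih =>
      obtain ⟨g, hg, y, hy1, hy2⟩ := ih
      have hpow : 1 ≤ (t / ‖v‖) ^ n := one_le_pow₀ h1.le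
      have ht0 : 0 < t := hl0.trans hlt
      have htn : t ≤ t * (t / ‖v‖) ^ n := le_mul_of_one_le_right ht0.le hpow
      obtain ⟨g', hg', z, hz1, hz2⟩ := hg.exists_of_overlap h hk0 hk hv hv0
        (ht0.trans_le htn) (by
          have e1 : l ^ 2 < (t * (t / ‖v‖) ^ n) ^ 2 := by gcongr; exact hlt.trans_le htn
          have e2 : ‖v‖ ^ 2 ≤ l ^ 2 := by gcongr
          linarith) hy1 hy2
      have e : t * (t / ‖v‖) ^ (n + 1) ≤ (t * (t / ‖v‖) ^ n) ^ 2 / ‖v‖ := by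
        rw [pow_succ, ← mul_assoc, sq, mul_div_assoc]
        gcongr
      exact ⟨g', hg', z, e.trans hz1, e.trans hz2⟩
  obtain ⟨n, hn⟩ := pow_unbounded_of_one_lt (U.level / t) h1
  rw [div_lt_iff₀' (hl0.trans hlt)] at hn
  obtain ⟨g', hg', y, hy1, hy2⟩ := key n
  exact (hn.trans_le hy2).not_ge (hg'.height_le h hk y (hn.trans_le hy1))

/-! ### Meridians -/

lemma exists_shortest (U : HoroballNbhd S) :
    ∃ v ∈ U.lattice, v ≠ 0 ∧ ∀ u ∈ U.lattice, u ≠ 0 → ‖v‖ ≤ ‖u‖ := by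
  have := U.discrete
  obtain ⟨u, hu, hu0⟩ : ∃ u ∈ U.lattice, u ≠ 0 := by
    by_contra! hall
    have : Submodule.span ℝ (U.lattice : Set ℂ) = ⊥ := Submodule.span_eq_bot.2 hall
    rw [U.spans] at this
    exact top_ne_bot this
  have hfin : (Metric.closedBall (0 : ℂ) ‖u‖ ∩ U.lattice).Finite :=
    Metric.finite_isBounded_inter_isClosed DiscreteTopology.isDiscrete Metric.isBounded_closedBall
      (inferInstanceAs (IsClosed (U.lattice.toAddSubgroup : Set ℂ)))
  obtain ⟨v, ⟨⟨hvu, hv1⟩, hv2⟩, hv⟩ := (hfin.subset (inter_subset_left (t := {0}ᶜ))).exists_minimalFor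
    norm _ ⟨u, ⟨by simp, hu⟩, hu0⟩
  refine ⟨v, hv1, hv2, fun w hw hw0 => ?_⟩
  rcases le_total ‖w‖ ‖v‖ with hle | hle
  · rw [mem_closedBall_zero_iff] at hvu
    exact hv ⟨⟨mem_closedBall_zero_iff.2 (hle.trans hvu), hw⟩, hw0⟩ hle
  · exact hle

/-- The straight segment in the direction of a shortest lattice vector is a meridian. -/
lemma exists_isMeridian (U : HoroballNbhd S) {v : ℂ} (hv : v ∈ U.lattice) (hv0 : v ≠ 0)
    (hmin : ∀ u ∈ U.lattice, u ≠ 0 → ‖v‖ ≤ ‖u‖) :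
    ∃ m, U.IsMeridian m ∧ U.curveLength m = ENNReal.ofReal (‖v‖ / U.level) := by
  have hvpos : 0 < ‖v‖ := norm_pos_iff.2 hv0
  let m : C(unitInterval, ℂ) := ⟨fun t => (t : ℝ) • v, by fun_prop⟩
  have hm : U.IsNontrivialSimpleClosedCurve m := by
    refine ⟨by simpa [m] using hv, by simpa [m] using hv0, fun s t hst hmem => ?_⟩
    have hst' : (s : ℝ) < t := hst
    have h1 : m t - m s = ((t : ℝ) - s) • v := by simp [m, sub_smul]
    rw [h1] at hmem
    have h2 := hmin _ hmem (smul_ne_zero (sub_pos.2 hst').ne' hv0)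
    rw [norm_smul, Real.norm_of_nonneg (sub_pos.2 hst').le] at h2
    have h3 : 1 ≤ (t : ℝ) - s := by nlinarith
    have hs := s.2.1
    have ht := t.2.2
    exact ⟨Subtype.ext (show (s : ℝ) = 0 by linarith), Subtype.ext (show (t : ℝ) = 1 by linarith)⟩
  have hlower : ∀ c, U.IsNontrivialSimpleClosedCurve c →
      ENNReal.ofReal ‖v‖ ≤ eVariationOn c univ := by
    intro c hc
    refine le_trans ?_ (eVariationOn.edist_le c (mem_univ 1) (mem_univ 0))
    rw [edist_dist, dist_eq_norm]
    exact ENNReal.ofReal_le_ofReal (hmin _ hc.1 (sub_ne_zero.2 hc.2.1))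
  have hupper : eVariationOn m univ ≤ ENNReal.ofReal ‖v‖ := by
    have hL : LipschitzWith ‖v‖₊ fun x : ℝ => x • v :=
      LipschitzWith.of_dist_le_mul fun x y => by
        rw [dist_eq_norm, ← sub_smul, norm_smul, mul_comm, Real.dist_eq, Real.norm_eq_abs]
        rfl
    have h1 := (hL.lipschitzOnWith (s := univ)).comp_eVariationOn_le
      (g := fun t : unitInterval => (t : ℝ)) (mapsTo_univ _ univ)
    have h2 : MonotoneOn (fun t : unitInterval => (t : ℝ)) univ := fun a _ b _ hab => hab
    have h3 := (h2.eVariationOn_eq (mem_univ 0) (mem_univ 1)).le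
    have h4 : (univ : Set unitInterval) ∩ Icc 0 1 = univ := by
      ext t
      simp [unitInterval.le_one']
    rw [h4] at h3
    refine h1.trans ((mul_le_mul_right h3 _).trans ?_)
    simp
  refine ⟨m, ⟨hm, fun c hc => ENNReal.div_le_div_right (hupper.trans (hlower c hc)) _⟩, ?_⟩
  rw [curveLength, le_antisymm hupper (hlower m hm), ENNReal.ofReal_div_of_pos U.level_pos]

end HoroballNbhd

theorem mainTheorem11 {M : Type*} [MetricSpace M] {S : Set M}
    (hM : IsHyperbolicConeManifold M S) (U₀ : HoroballNbhd S)
    (R : ℝ) (hR : Real.log (2 / Real.sqrt 3) ≤ R) (hRS : ENNReal.ofReal R ≤ tubeRadius S) :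
    ∃ U : HoroballNbhd S, U.SameCusp U₀ ∧
      ∃ m : C(unitInterval, ℂ), U.IsMeridian m ∧
        ENNReal.ofReal (1 - Real.exp (-2 * R)) ≤ U.curveLength m := by
  obtain ⟨v, hv, hv0, hmin⟩ := U₀.exists_shortest
  have hvpos : 0 < ‖v‖ := norm_pos_iff.2 hv0
  -- the hypothesis on `R` says that `exp (-R) ≤ √3 / 2`
  have hexp : Real.exp (-R) ^ 2 ≤ 3 / 4 := by
    have h3 : 0 < Real.sqrt 3 := by positivity
    have h1 : 2 / Real.sqrt 3 ≤ Real.exp R := (Real.log_le_iff_le_exp (by positivity)).1 hR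
    have h2 : Real.exp (-R) ≤ Real.sqrt 3 / 2 := by
      rw [Real.exp_neg, ← inv_div]
      gcongr
    calc Real.exp (-R) ^ 2 ≤ (Real.sqrt 3 / 2) ^ 2 := by gcongr
      _ = 3 / 4 := by rw [div_pow, Real.sq_sqrt (by norm_num)]; norm_num
  have he2 : Real.exp (-2 * R) = Real.exp (-R) ^ 2 := by
    rw [← Real.exp_nat_mul]
    congr 1
    push_cast
    ring
  have he0 := Real.exp_pos (-R)
  have hR0 : 0 < R := by
    by_contra! hneg
    have : 1 ≤ Real.exp (-R) := Real.one_le_exp (by linarith)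
    nlinarith
  have hd : 0 < 1 - Real.exp (-2 * R) := by rw [he2]; linarith
  suffices H : ∃ U : HoroballNbhd S, U.SameCusp U₀ ∧ U.lattice = U₀.lattice ∧
      U.level ≤ ‖v‖ / (1 - Real.exp (-2 * R)) by
    obtain ⟨U, hU, hlat, hlev⟩ := H
    obtain ⟨m, hm, hlen⟩ := U.exists_isMeridian (by rwa [hlat]) hv0 (by rwa [hlat])
    refine ⟨U, hU, m, hm, ?_⟩
    rw [hlen]
    apply ENNReal.ofReal_le_ofReal
    rw [le_div_iff₀ hd] at hlev
    rw [le_div_iff₀ U.level_pos]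
    linarith
  set l := ‖v‖ / (1 - Real.exp (-2 * R)) with hl_def
  rcases le_or_gt U₀.level l with hle | hlt
  · exact ⟨U₀, Or.inl subset_rfl, rfl, hle⟩
  obtain ⟨F, hF⟩ := HoroballNbhd.exists_isExtension hM U₀ hR0 hRS hv hv0
  have hl : 0 < l := by positivity
  have hk : ‖v‖ / (2 * Real.sinh R) = l * Real.exp (-R) := by
    have hs : 2 * Real.sinh R = (1 - Real.exp (-2 * R)) / Real.exp (-R) := by
      rw [he2, Real.sinh_eq, Real.exp_neg]
      field_simp
    rw [hs, hl_def]
    field_simp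
  rw [hk] at hF
  have he1 : Real.exp (-R) ≤ 1 := Real.exp_le_one_iff.2 (by linarith)
  have hkl : l * Real.exp (-R) ≤ l := mul_le_of_le_one_right hl.le he1
  have hvl : ‖v‖ ≤ l := by
    rw [hl_def, le_div_iff₀ hd]
    nlinarith [Real.exp_pos (-2 * R)]
  refine ⟨{ level := l
            level_pos := hl
            lattice := U₀.lattice
            discrete := U₀.discrete
            spans := U₀.spans
            param := F
            locallyIsometric := fun p hp => hF.1 p (hkl.trans_lt hp)
            param_notMem := fun p hp => hF.2 p (hkl.trans_lt hp)
            param_eq_iff := fun p q hp hq => ⟨fun hpq => ?_, ?_⟩ }, Or.inr ?_, rfl, le_rfl⟩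
  · refine hF.exists_translate_of_eq (by positivity) (hkl.trans hlt.le) hkl hv hv0 hvl ?_ hp hq hpq
    rw [mul_pow]
    nlinarith [mul_le_mul_of_nonneg_left hexp (sq_nonneg l)]
  · rintro ⟨u, hu, rfl⟩
    exact (hF.translate hu (hkl.trans_lt hp)).symm
  · rintro _ ⟨p, hp, rfl⟩
    exact ⟨p, hlt.trans hp, hF.3 p hp⟩
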